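/- **Setting.** Write $\omega(\tau)=\tau-\ln(1+\tau)$ for $\tau\ge 0$ and $\omega_*(\tau)=-\tau-\ln(1-\tau)$ for $\tau\in[0,1)$. For a symmetric positive definite matrix $Q$ write $\|v\|_Q=(v^\top Qv)^{1/2}$, and let $\preceq$ be the Loewner order. Let $\varphi:\mathbb R^n\to\mathbb R\cup\{+\infty\}$ be proper, closed and convex with open domain, $C^3$ on $\mathrm{dom}\,\varphi$, with $\nabla^2\varphi(u)\succ0$ for all $u\in\mathrm{dom}\,\varphi$, and standard self-concordant: for all $u\in\mathrm{dom}\,\varphi$ and $v\in\mathbb R^n$ the function $h(\tau)=\varphi(u+\tau v)$ satisfies $|h'''|\le 2(h'')^{3/2}$ on its domain. Let $A\in\mathbb R^{p\times n}$ and $$f(x)=\max_{u\in\mathrm{dom}\,\varphi}\{\langle u,A^\top x\rangle-\varphi(u)\},\qquad \mathrm{dom}f=\{x\in\mathbb R^p:\ \varphi(u)-\langle u,A^\top x\rangle\text{ is bounded below on }\mathrm{dom}\,\varphi\},$$ and let $u^*(x)=\arg\min_{u\in\mathrm{dom}\,\varphi}\{\varphi(u)-\langle u,A^\top x\rangle\}$.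 For $x\in\mathrm{dom}f$ and $\delta\ge0$, a point $\tilde u\in\mathrm{dom}\,\varphi$ is a *$\delta$-solution at $x$* if $u^*(x)$ exists and $\|\tilde u-u^*(x)\|_{\nabla^2\varphi(\tilde u)}\le\delta$. For a convex function $f$, a triple $(\check f,g,H)$ of maps defined on $\mathrm{dom} f$, with values in $\mathbb R$, $\mathbb R^p$ and the symmetric $p\times p$ matrices, is a *$(\delta_0,\delta_1)$-global inexact oracle* of $f$, where $\delta_0\in[0,1]$ and $\delta_1\ge0$, if for all $x\in\mathrm{dom}f$ we have $H(x)\succ0$, and every $y\in\mathbb R^p$ with $r:=\|y-x\|_{H(x)}<\frac1{1+\delta_0}$ lies in $\mathrm{dom}f$ and satisfies $$\omega((1-\delta_0)r)\le f(y)-\check f(x)-\langle g(x),y-x\rangle\le\omega_*((1+\delta_0)r)+\delta_1 .$$ For $\delta_2,\delta_3\ge 0$ with $2\delta_2+\delta_3<1$ put $$\underline c=\sqrt{(1-\delta_2-\delta_3)^2+(1-\delta_3)(1-2\delta_2-\delta_3)},\qquad \bar c=\sqrt{9(1+\delta_2+\delta_3)^2-3(1+\delta_3)(1+2\delta_2+\delta_3)},$$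 $$\underline\psi^*(\delta_2,\delta_3)=\frac{\delta_2}{(1-\delta_2-\delta_3)+\underline c}-\ln\Big(1+\frac{2\delta_2}{(2-3\delta_2-2\delta_3)+\underline c}\Big),$$ $$\bar\psi^*(\delta_2,\delta_3)=\frac{3\delta_2}{3(1+\delta_2+\delta_3)+\bar c}-\ln\Big(1+\frac{2\delta_2}{(2+\delta_2+2\delta_3)+\bar c}\Big).$$ **Lemma.** (a) Let $A$ have full row rank $p$, let $0\le\delta\le0.292$, and for every $x\in\mathrm{dom}f$ let $\tilde u^*(x)$ be a $\delta$-solution at $x$. Put $$\tilde f(x)=\langle\tilde u^*(x),A^\top x\rangle-\varphi(\tilde u^*(x)),\quad g(x)=A\tilde u^*(x),\quad H(x)=A[\nabla^2\varphi(\tilde u^*(x))]^{-1}A^\top,$$ $\delta_3=\frac{\delta}{1-\delta}$, $\varepsilon=\omega_*(\delta_3)$, $\delta_0=2\delta+\delta_3$, $\delta_1=\max\{0,\,2\varepsilon+\bar\psi^*(\delta,\delta_3)-\underline\psi^*(\delta,\delta_3)\}$ and $\hat f(x)=\tilde f(x)-\varepsilon+\underline\psi^*(\delta,\delta_3)$.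 Then $f$ is convex on $\mathrm{dom} f$ and $(\hat f,g,H)$ is a $(\delta_0,\delta_1)$-global inexact oracle of $f$. Moreover, at every $x\in\mathrm{dom}f$ the function $f$ is twice continuously differentiable and $$\|g(x)-\nabla f(x)\|_{H(x)^{-1}}\le\delta,\qquad(1-\delta_3)^2\nabla^2f(x)\preceq H(x)\preceq(1+\delta_3)^2\nabla^2f(x).$$ (b) (For arbitrary $A$.) Let $\delta\ge0$, $x\in\mathrm{dom}f$ and $\tilde u\in\mathrm{dom}\,\varphi$. If $\|\nabla\varphi(\tilde u)-A^\top x\|_{[\nabla^2\varphi(\tilde u)]^{-1}}\le\frac{\delta}{1+\delta}$, then $\tilde u$ is a $\delta$-solution at $x$. -/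

import Mathlib

open scoped Matrix

noncomputable section

namespace SCOracle

/-! Vectors of `ℝᵈ` are functions `Fin d → ℝ`; the inner product is the dot product `⬝ᵥ`, and all
norms are the explicit quadratic-form norms below (the sup norm of `Fin d → ℝ` is used only for its
topology and differential calculus, which do not depend on the choice of a norm). -/

/-- `ω(τ) = τ - ln(1 + τ)`, used for `τ ≥ 0`. -/
def omega (τ : ℝ) : ℝ := τ - Real.log (1 + τ)

/-- `ω_*(τ) = -τ - ln(1 - τ)`, used for `0 ≤ τ < 1`. -/
def omegaStar (τ : ℝ) : ℝ := -τ - Real.log (1 - τ)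

/-- The gradient: the vector of partial derivatives. -/
def grad {d : ℕ} (f : (Fin d → ℝ) → ℝ) (x : Fin d → ℝ) : Fin d → ℝ :=
  fun i => fderiv ℝ f x (Pi.single i 1)

/-- The Hessian: the matrix of second partial derivatives. -/
def hess {d : ℕ} (f : (Fin d → ℝ) → ℝ) (x : Fin d → ℝ) : Matrix (Fin d) (Fin d) ℝ :=
  Matrix.of fun i j => fderiv ℝ (fderiv ℝ f) x (Pi.single i 1) (Pi.single j 1)

/-- `(vᵀ H v)^{1/2}`. -/
def wnorm {d : ℕ} (H : Matrix (Fin d) (Fin d) ℝ) (v : Fin d → ℝ) : ℝ :=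
  Real.sqrt (v ⬝ᵥ (H *ᵥ v))

/-- The dual norm `(vᵀ H⁻¹ v)^{1/2}`. -/
def wnormDual {d : ℕ} (H : Matrix (Fin d) (Fin d) ℝ) (v : Fin d → ℝ) : ℝ :=
  wnorm H⁻¹ v

/-- A univariate convex `C³` function on an open domain `S` with `|h'''| ≤ M (h'')^{3/2}` on `S`. -/
structure IsUnivariateSelfConcordant (M : ℝ) (h : ℝ → ℝ) (S : Set ℝ) : Prop where
  isOpen : IsOpen S
  convexOn : ConvexOn ℝ S h
  contDiffOn : ContDiffOn ℝ 3 h S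
  bound : ∀ τ ∈ S, |iteratedDeriv 3 h τ| ≤ M * (iteratedDeriv 2 h τ) ^ (3 / 2 : ℝ)

/-- A proper closed convex function `φ : ℝⁿ → ℝ ∪ {+∞}` with open domain `D` (only the values on `D`
matter; the function is `+∞` outside) that is three times continuously differentiable on `D`, is
standard self-concordant (`M = 2` along every line), and has a positive definite Hessian on `D`. -/
structure IsStandardSelfConcordant {n : ℕ} (φ : (Fin n → ℝ) → ℝ) (D : Set (Fin n → ℝ)) : Prop where
  nonempty : D.Nonempty
  isOpen : IsOpen D
  convexOn : ConvexOn ℝ D φ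
  closed_epigraph : IsClosed {q : (Fin n → ℝ) × ℝ | q.1 ∈ D ∧ φ q.1 ≤ q.2}
  contDiffOn : ContDiffOn ℝ 3 φ D
  along_lines : ∀ u ∈ D, ∀ v : Fin n → ℝ,
    IsUnivariateSelfConcordant 2 (fun τ : ℝ => φ (u + τ • v)) {τ : ℝ | u + τ • v ∈ D}
  hess_posDef : ∀ u ∈ D, (hess φ u).PosDef

/-- A `(δ₀, δ₁)`-global inexact oracle `(ft, g, H)` of the convex function `f` with domain `X`. -/
structure IsGlobalInexactOracle {p : ℕ} (f : (Fin p → ℝ) → ℝ) (X : Set (Fin p → ℝ))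
    (ft : (Fin p → ℝ) → ℝ) (g : (Fin p → ℝ) → Fin p → ℝ)
    (H : (Fin p → ℝ) → Matrix (Fin p) (Fin p) ℝ) (δ₀ δ₁ : ℝ) : Prop where
  convexOn : ConvexOn ℝ X f
  acc₀ : 0 ≤ δ₀ ∧ δ₀ ≤ 1
  acc₁ : 0 ≤ δ₁
  oracle : ∀ x ∈ X, (H x).PosDef ∧
    ∀ y : Fin p → ℝ, wnorm (H x) (y - x) < 1 / (1 + δ₀) →
      y ∈ X ∧
      omega ((1 - δ₀) * wnorm (H x) (y - x)) ≤ f y - ft x - g x ⬝ᵥ (y - x) ∧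
      f y - ft x - g x ⬝ᵥ (y - x) ≤ omegaStar ((1 + δ₀) * wnorm (H x) (y - x)) + δ₁

section MaxFunction

variable {n p : ℕ} (φ : (Fin n → ℝ) → ℝ) (D : Set (Fin n → ℝ)) (A : Matrix (Fin p) (Fin n) ℝ)

/-- `f(x) = max_{u ∈ D} {⟨u, Aᵀx⟩ - φ(u)}`, a genuine finite supremum for `x` in `maxDom φ D A`. -/
def maxFun (x : Fin p → ℝ) : ℝ :=
  sSup ((fun u => u ⬝ᵥ (Aᵀ *ᵥ x) - φ u) '' D)

/-- `dom f`: the `x` for which `φ(u) - ⟨u, Aᵀx⟩` is bounded below on `D`. -/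
def maxDom : Set (Fin p → ℝ) :=
  {x | BddBelow ((fun u => φ u - u ⬝ᵥ (Aᵀ *ᵥ x)) '' D)}

/-- `us` is a solution `u*(x)` of `min_{u ∈ D} {φ(u) - ⟨u, Aᵀx⟩}`. -/
def IsExactSolution (x : Fin p → ℝ) (us : Fin n → ℝ) : Prop :=
  us ∈ D ∧ ∀ u ∈ D, φ us - us ⬝ᵥ (Aᵀ *ᵥ x) ≤ φ u - u ⬝ᵥ (Aᵀ *ᵥ x)

/-- `ut` is a `δ`-solution: `u*(x)` exists, and `‖ut - u*(x)‖_{ut} ≤ δ` in the local norm of `φ`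
(`u*(x)` is unique for the strictly convex `φ` considered here). -/
def IsDeltaSolution (x : Fin p → ℝ) (δ : ℝ) (ut : Fin n → ℝ) : Prop :=
  ut ∈ D ∧ ∃ us, IsExactSolution φ D A x us ∧ wnorm (hess φ ut) (ut - us) ≤ δ

/-- `f̃(x) = ⟨ũ(x), Aᵀx⟩ - φ(ũ(x))`. -/
def approxVal (ut : (Fin p → ℝ) → Fin n → ℝ) (x : Fin p → ℝ) : ℝ :=
  ut x ⬝ᵥ (Aᵀ *ᵥ x) - φ (ut x)

/-- `g(x) = A ũ(x)`. -/
def approxGrad (ut : (Fin p → ℝ) → Fin n → ℝ) (x : Fin p → ℝ) : Fin p → ℝ :=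
  A *ᵥ ut x

/-- `H(x) = A [∇²φ(ũ(x))]⁻¹ Aᵀ`. -/
def approxHess (ut : (Fin p → ℝ) → Fin n → ℝ) (x : Fin p → ℝ) : Matrix (Fin p) (Fin p) ℝ :=
  A * (hess φ (ut x))⁻¹ * Aᵀ

end MaxFunction

def cLower (δ₂ δ₃ : ℝ) : ℝ :=
  Real.sqrt ((1 - δ₂ - δ₃) ^ 2 + (1 - δ₃) * (1 - 2 * δ₂ - δ₃))

def cUpper (δ₂ δ₃ : ℝ) : ℝ :=
  Real.sqrt (9 * (1 + δ₂ + δ₃) ^ 2 - 3 * (1 + δ₃) * (1 + 2 * δ₂ + δ₃))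

/-- The minimum over `t ≥ 0` of `-δ₂ t + ω((1-δ₃) t) - ω((1-2δ₂-δ₃) t)`, in closed form. -/
def psiLower (δ₂ δ₃ : ℝ) : ℝ :=
  δ₂ / ((1 - δ₂ - δ₃) + cLower δ₂ δ₃)
    - Real.log (1 + 2 * δ₂ / ((2 - 3 * δ₂ - 2 * δ₃) + cLower δ₂ δ₃))

/-- The maximum over `0 ≤ t < 1/(1+2δ₂+δ₃)` of `δ₂ t + ω_*((1+δ₃) t) - ω_*((1+2δ₂+δ₃) t)`,
in closed form. -/
def psiUpper (δ₂ δ₃ : ℝ) : ℝ :=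
  3 * δ₂ / (3 * (1 + δ₂ + δ₃) + cUpper δ₂ δ₃)
    - Real.log (1 + 2 * δ₂ / ((2 + δ₂ + 2 * δ₃) + cUpper δ₂ δ₃))

/-- `δ₀ = 2δ₂ + δ₃`. -/
def acc0 (δ₂ δ₃ : ℝ) : ℝ := 2 * δ₂ + δ₃

/-- `δ₁ = max{0, 2ε + ψ̄(δ₂,δ₃) - ψ̲(δ₂,δ₃)}`. -/
def acc1 (ε δ₂ δ₃ : ℝ) : ℝ := max 0 (2 * ε + psiUpper δ₂ δ₃ - psiLower δ₂ δ₃)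

end SCOracle

end

namespace SCOracle

/-! Everything rests on two facts. A standard self-concordant `φ` deviates from its linearisation by
at least `ω(r)` and at most `ω_*(r)`, where `r` is the local distance, and `ω`, `ω_*` are Legendre
conjugates. So the max function `f`, the conjugate of `φ` composed with `Aᵀ`, satisfies the same
pair of bounds around any `x` at which the exact maximiser `u*` exists, in the norm of `A
[∇²φ(u*)]⁻¹ Aᵀ = ∇²f(x)` (`le_maxFun_of_exact`, `pairing_le_of_exact`, `contDiffAt_maxFun`).

Replacing `u*` by a δ-solution `ũ` causes three errors: the value drops by at most `ε = ω_*(δ₃)`,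
the linear term changes by at most `δ t` with `t = ‖y - x‖_H`, and the exact norm lies between `(1 -
δ₃) t` and `(1 + δ₃) t`. The last follows from comparing Hessians at nearby points
(`hessForm_comparison`), which requires the mixed third-derivative bound `trilinear_le`. Optimising
the resulting scalar expressions over `t` gives the closed forms `psiLower` and `psiUpper`.

For (b), a small Newton decrement makes a tilted `φ` coercive, so `u*` exists, and growth of the
gradient along the segment bounds its distance from `ũ`. -/

/-! ### Scalar inequalities: conjugacy of `ω` and `ω_*`, and the closed forms of the accuracy -/

theorem mul_sub_omegaStar_eq_omega {r : ℝ} (hr : 0 ≤ r) :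
    r / (1 + r) * r - omegaStar (r / (1 + r)) = omega r := by
  have h1 : (1 + r) ≠ 0 := by positivity
  have h2 : 1 - r / (1 + r) = (1 + r)⁻¹ := by field_simp; ring
  rw [omegaStar, omega, h2, Real.log_inv]
  field_simp
  ring

/-- Fenchel–Young for the conjugate pair; it is `log X ≤ X - 1` at `X = (1 + s)(1 - r)`. -/
theorem mul_sub_omega_le_omegaStar {r s : ℝ} (hr : r < 1) (hs : 0 ≤ s) :
    s * r - omega s ≤ omegaStar r := by
  have h1 : 0 < 1 + s := by positivity
  have h2 : 0 < 1 - r := by linarith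
  have h := Real.log_le_sub_one_of_pos (mul_pos h1 h2)
  rw [Real.log_mul h1.ne' h2.ne'] at h
  rw [omega, omegaStar]
  linarith

theorem omegaStar_mono {r s : ℝ} (hr : 0 ≤ r) (hrs : r ≤ s) (hs : s < 1) :
    omegaStar r ≤ omegaStar s := by
  have h1 : 0 < 1 - r := by linarith
  have h2 : 0 < 1 - s := by linarith
  have h := Real.log_le_sub_one_of_pos (div_pos h2 h1)
  rw [Real.log_div h2.ne' h1.ne'] at h
  have h3 : (1 - s) / (1 - r) ≤ 1 - (s - r) := by
    rw [div_le_iff₀ h1]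
    nlinarith
  rw [omegaStar, omegaStar]
  linarith

theorem omega_mono {r s : ℝ} (hr : 0 ≤ r) (hrs : r ≤ s) : omega r ≤ omega s := by
  have h1 : 0 < 1 + r := by linarith
  have h2 : 0 < 1 + s := by linarith
  have h := Real.log_le_sub_one_of_pos (div_pos h2 h1)
  rw [Real.log_div h2.ne' h1.ne'] at h
  have h3 : (1 + s) / (1 + r) ≤ 1 + (s - r) := by
    rw [div_le_iff₀ h1]
    nlinarith
  rw [omega, omega]
  linarith

theorem omega_nonneg {r : ℝ} (hr : 0 ≤ r) : 0 ≤ omega r := by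
  simpa [omega] using omega_mono le_rfl hr

/-- With `a = 1 - δ₃` and `b = 1 - 2δ₂ - δ₃`, the function `-δ₂ t + ω(a t) - ω(b t)` is stationary
where `(1 + a t)(1 + b t) = 2`. Its minimiser is `t = 1/s` for the `s` below, and `psiLower` is the
value there. -/
theorem omega_acc0_le {δ₂ δ₃ t : ℝ} (h2 : 0 ≤ δ₂) (h : 2 * δ₂ + δ₃ < 1)
    (ht : 0 ≤ t) :
    omega ((1 - acc0 δ₂ δ₃) * t) ≤ -δ₂ * t + omega ((1 - δ₃) * t) - psiLower δ₂ δ₃ := by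
  obtain ⟨a, ha⟩ : ∃ a, a = 1 - δ₃ := ⟨_, rfl⟩
  obtain ⟨b, hb⟩ : ∃ b, b = 1 - 2 * δ₂ - δ₃ := ⟨_, rfl⟩
  have hb0 : 0 < b := by linarith
  have ha0 : 0 < a := by linarith
  obtain ⟨c, hc⟩ : ∃ c, c = cLower δ₂ δ₃ := ⟨_, rfl⟩
  have hc0 : 0 ≤ c := by rw [hc]; exact Real.sqrt_nonneg _
  have hc2 : c ^ 2 = (1 - δ₂ - δ₃) ^ 2 + a * b := by
    rw [hc, cLower, Real.sq_sqrt, ha, hb]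
    rw [← ha, ← hb]
    positivity
  obtain ⟨s, hs⟩ : ∃ s, s = (1 - δ₂ - δ₃) + c := ⟨_, rfl⟩
  have hs0 : 0 < s := by linarith
  have hmul : (s + a) * (s + b) = 2 * s ^ 2 := by
    have : c = s - (a + b) / 2 := by linarith
    rw [this, show 1 - δ₂ - δ₃ = (a + b) / 2 by linarith] at hc2
    linarith
  have e1 : 1 + 2 * δ₂ / ((2 - 3 * δ₂ - 2 * δ₃) + c) = (s + a) / (s + b) := by
    have : (2 - 3 * δ₂ - 2 * δ₃) + c = s + b := by linarith
    rw [this, eq_div_iff (by positivity), add_mul, div_mul_cancel₀ _ (by positivity)]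
    linarith
  have p1 : 0 < 1 + a * t := by positivity
  have p2 : 0 < 1 + b * t := by positivity
  have p3 : 0 < s + a := by positivity
  have p4 : 0 < s + b := by positivity
  -- The ratio compares `(1 + a t)/(1 + b t)` with its value at `t = 1/s`, so this logarithm bound
  -- is sharp at the minimiser. The slack that remains is a multiple of `(s t - 1)²`.
  have hl := Real.log_le_sub_one_of_pos (div_pos (mul_pos p1 p4) (mul_pos p2 p3))
  rw [Real.log_div (by positivity) (by positivity), Real.log_mul p1.ne' p4.ne',
    Real.log_mul p2.ne' p3.ne'] at hl
  have key : (1 + a * t) * (s + b) / ((1 + b * t) * (s + a)) - 1 ≤ δ₂ * t - δ₂ / s := by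
    have hab : a - b = 2 * δ₂ := by linarith
    have : δ₂ * t - δ₂ / s - ((1 + a * t) * (s + b) / ((1 + b * t) * (s + a)) - 1)
        = δ₂ * b * (s * t - 1) ^ 2 / (s ^ 2 * (1 + b * t)) := by
      have hsa : s + a = 2 * s ^ 2 / (s + b) := by rw [eq_div_iff p4.ne', hmul]
      have : (1 + a * t) * (s + b) / ((1 + b * t) * (s + a)) - 1
          = δ₂ * (s * t - 1) * (s + b) / (s ^ 2 * (1 + b * t)) := by
        rw [div_sub_one (by positivity), div_eq_div_iff (by positivity) (by positivity)]
        linear_combination (s * t - 1) * (s ^ 2 * (1 + b * t)) * hab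
          - δ₂ * (s * t - 1) * (1 + b * t) * hmul
      rw [this]
      field_simp
      ring
    have h0 : 0 ≤ δ₂ * b * (s * t - 1) ^ 2 / (s ^ 2 * (1 + b * t)) := by positivity
    linarith
  rw [psiLower, ← hc, e1, ← hs, Real.log_div p3.ne' p4.ne', omega, omega, acc0, ← ha,
    show 1 - (2 * δ₂ + δ₃) = b by linarith]
  have : a * t - b * t = 2 * (δ₂ * t) := by rw [ha, hb]; ring
  linarith

/-- The same tangent argument for a maximum: with `a = 1 + δ₃` and `b = 1 + 2δ₂ + δ₃`, stationarity
reads `3(1 - a t)(1 - b t) = 2`, solved by `t = 1/s`. -/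
theorem le_omegaStar_acc0 {δ₂ δ₃ t : ℝ} (h2 : 0 ≤ δ₂) (h3 : 0 ≤ δ₃)
    (ht : 0 ≤ t) (ht1 : t < 1 / (1 + acc0 δ₂ δ₃)) :
    δ₂ * t + omegaStar ((1 + δ₃) * t) ≤ omegaStar ((1 + acc0 δ₂ δ₃) * t) + psiUpper δ₂ δ₃ := by
  obtain ⟨a, ha⟩ : ∃ a, a = 1 + δ₃ := ⟨_, rfl⟩
  obtain ⟨b, hb⟩ : ∃ b, b = 1 + 2 * δ₂ + δ₃ := ⟨_, rfl⟩
  have hb0 : 0 < b := by linarith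
  have ha0 : 0 < a := by linarith
  have hbb : 1 + acc0 δ₂ δ₃ = b := by rw [acc0]; linarith
  rw [hbb, lt_div_iff₀ hb0] at ht1
  obtain ⟨c, hc⟩ : ∃ c, c = cUpper δ₂ δ₃ := ⟨_, rfl⟩
  have hc0 : 0 ≤ c := by rw [hc]; exact Real.sqrt_nonneg _
  have hc2 : c ^ 2 = 9 * (1 + δ₂ + δ₃) ^ 2 - 3 * a * b := by
    rw [hc, cUpper, Real.sq_sqrt, ha, hb]
    nlinarith [mul_nonneg h2 h3, sq_nonneg (1 + δ₂ + δ₃), sq_nonneg δ₂]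
  obtain ⟨s, hs⟩ : ∃ s, s = 3 * (1 + δ₂ + δ₃) + c := ⟨_, rfl⟩
  have hs0 : 0 < s := by linarith
  have p3 : 0 < s - a := by linarith
  have p4 : 0 < s - b := by linarith
  have hmul : 3 * ((s - a) * (s - b)) = 2 * s ^ 2 := by
    have : c = s - 3 * ((a + b) / 2) := by linarith
    rw [this, show 1 + δ₂ + δ₃ = (a + b) / 2 by linarith] at hc2
    linarith
  have e1 : 1 + 2 * δ₂ / ((2 + δ₂ + 2 * δ₃) + c) = (s - a) / (s - b) := by
    have : (2 + δ₂ + 2 * δ₃) + c = s - b := by linarith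
    rw [this, eq_div_iff (by positivity), add_mul, div_mul_cancel₀ _ (by positivity)]
    linarith
  have p2 : 0 < 1 - b * t := by linarith
  have p1 : 0 < 1 - a * t := by nlinarith
  have hl := Real.log_le_sub_one_of_pos (div_pos (mul_pos p2 p3) (mul_pos p1 p4))
  rw [Real.log_div (by positivity) (by positivity), Real.log_mul p2.ne' p3.ne',
    Real.log_mul p1.ne' p4.ne'] at hl
  have key : (1 - b * t) * (s - a) / ((1 - a * t) * (s - b)) - 1 ≤ 3 * δ₂ / s - 3 * δ₂ * t := by
    have hab : b - a = 2 * δ₂ := by linarith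
    have : 3 * δ₂ / s - 3 * δ₂ * t - ((1 - b * t) * (s - a) / ((1 - a * t) * (s - b)) - 1)
        = 3 * δ₂ * a * (s * t - 1) ^ 2 / (s ^ 2 * (1 - a * t)) := by
      have : (1 - b * t) * (s - a) / ((1 - a * t) * (s - b)) - 1
          = - (3 * δ₂ * (s * t - 1) * (s - a) / (s ^ 2 * (1 - a * t))) := by
        rw [div_sub_one (by positivity), ← neg_div, div_eq_div_iff (by positivity) (by positivity)]
        linear_combination -(s * t - 1) * (s ^ 2 * (1 - a * t)) * hab
          + δ₂ * (s * t - 1) * (1 - a * t) * hmul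
      rw [this]
      have hne := p1.ne'
      generalize hw : 1 - a * t = w at hne ⊢
      field_simp
      rw [← hw]
      ring
    have h0 : 0 ≤ 3 * δ₂ * a * (s * t - 1) ^ 2 / (s ^ 2 * (1 - a * t)) := by positivity
    linarith
  rw [psiUpper, ← hc, e1, ← hs, Real.log_div p3.ne' p4.ne', hbb, omegaStar, omegaStar, ← ha]
  have : b * t - a * t = 2 * (δ₂ * t) := by rw [ha, hb]; ring
  linarith

/-! ### From the diagonal to the mixed bound for symmetric trilinear forms -/

/-- Szegő's form of Bernstein's inequality for binary cubic forms. -/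
theorem cubic_form_polar_le {A B C D M : ℝ}
    (h : ∀ x y : ℝ, x ^ 2 + y ^ 2 = 1 →
      A * x ^ 3 + 3 * B * x ^ 2 * y + 3 * C * x * y ^ 2 + D * y ^ 3 ≤ M) (a b : ℝ) :
    A * a + B * b ≤ M * Real.sqrt (a ^ 2 + b ^ 2) := by
  -- The angle is written as `3t` because the identities below express `A cos 3t + B sin 3t` as a
  -- convex combination of values of the cubic form on the unit circle.
  obtain ⟨t, ha, hb⟩ : ∃ t, a = Real.sqrt (a ^ 2 + b ^ 2) * Real.cos (3 * t) ∧
      b = Real.sqrt (a ^ 2 + b ^ 2) * Real.sin (3 * t) := by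
    have hn : ‖(⟨a, b⟩ : ℂ)‖ = Real.sqrt (a ^ 2 + b ^ 2) := by
      rw [Complex.norm_def, Complex.normSq_mk]; ring_nf
    refine ⟨Complex.arg ⟨a, b⟩ / 3, ?_, ?_⟩
    · rw [← hn, mul_div_cancel₀ _ (by norm_num : (3 : ℝ) ≠ 0), Complex.norm_mul_cos_arg]
    · rw [← hn, mul_div_cancel₀ _ (by norm_num : (3 : ℝ) ≠ 0), Complex.norm_mul_sin_arg]
  set ρ := Real.sqrt (a ^ 2 + b ^ 2)
  have hρ : 0 ≤ ρ := Real.sqrt_nonneg _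
  suffices A * Real.cos (3 * t) + B * Real.sin (3 * t) ≤ M by
    calc A * a + B * b = ρ * (A * Real.cos (3 * t) + B * Real.sin (3 * t)) := by
          rw [ha, hb]; ring
      _ ≤ ρ * M := mul_le_mul_of_nonneg_left this hρ
      _ = M * ρ := mul_comm _ _
  rw [Real.cos_three_mul, Real.sin_three_mul]
  set x := Real.cos t
  set y := Real.sin t
  have hxy : x ^ 2 + y ^ 2 = 1 := Real.cos_sq_add_sin_sq t
  obtain ⟨q, hq⟩ : ∃ q : ℝ, q = Real.sqrt 3 := ⟨_, rfl⟩
  have hq2 : q ^ 2 = 3 := by rw [hq]; exact Real.sq_sqrt (by norm_num)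
  -- `(u, v)` and `(w, z)` are `(x, y)` rotated by `±120°`.
  obtain ⟨u, hu⟩ : ∃ u, u = -x / 2 - q / 2 * y := ⟨_, rfl⟩
  obtain ⟨v, hv⟩ : ∃ v, v = -y / 2 + q / 2 * x := ⟨_, rfl⟩
  obtain ⟨w, hw⟩ : ∃ w, w = -x / 2 + q / 2 * y := ⟨_, rfl⟩
  obtain ⟨z, hz⟩ : ∃ z, z = -y / 2 - q / 2 * x := ⟨_, rfl⟩
  -- The weight is the Fejér kernel `(1 + 2 cos 2t)² / 9` in terms of `x = cos t`. Over the three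
  -- nodes the weights sum to one, and they reproduce `cos 3t` and `sin 3t` while killing the terms
  -- in `C` and `D`.
  have k (x y : ℝ) (hxy : x ^ 2 + y ^ 2 = 1) := mul_le_mul_of_nonneg_left (h x y hxy)
    (by positivity : 0 ≤ 16 / 9 * (x ^ 2 - 1 / 4) ^ 2)
  have h1 := k x y hxy
  have h2 := k u v (by grind)
  have h3 := k w z (by grind)
  have e0 : 16 / 9 * (x ^ 2 - 1 / 4) ^ 2 + 16 / 9 * (u ^ 2 - 1 / 4) ^ 2
      + 16 / 9 * (w ^ 2 - 1 / 4) ^ 2 = 1 := by grind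
  have eA : 16 / 9 * (x ^ 2 - 1 / 4) ^ 2 * x ^ 3 + 16 / 9 * (u ^ 2 - 1 / 4) ^ 2 * u ^ 3
      + 16 / 9 * (w ^ 2 - 1 / 4) ^ 2 * w ^ 3 = 4 * x ^ 3 - 3 * x := by grind
  have eB : 16 / 9 * (x ^ 2 - 1 / 4) ^ 2 * (x ^ 2 * y) + 16 / 9 * (u ^ 2 - 1 / 4) ^ 2 * (u ^ 2 * v)
      + 16 / 9 * (w ^ 2 - 1 / 4) ^ 2 * (w ^ 2 * z) = (3 * y - 4 * y ^ 3) / 3 := by grind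
  have eC : 16 / 9 * (x ^ 2 - 1 / 4) ^ 2 * (x * y ^ 2) + 16 / 9 * (u ^ 2 - 1 / 4) ^ 2 * (u * v ^ 2)
      + 16 / 9 * (w ^ 2 - 1 / 4) ^ 2 * (w * z ^ 2) = 0 := by grind
  have eD : 16 / 9 * (x ^ 2 - 1 / 4) ^ 2 * y ^ 3 + 16 / 9 * (u ^ 2 - 1 / 4) ^ 2 * v ^ 3
      + 16 / 9 * (w ^ 2 - 1 / 4) ^ 2 * z ^ 3 = 0 := by grind
  linear_combination h1 + h2 + h3 - A * eA - 3 * B * eB - 3 * C * eC - D * eD + M * e0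

/-- A symmetric trilinear form that is bounded by the cube of a Euclidean norm on the diagonal
satisfies the corresponding mixed bound. -/
theorem trilinear_le {E : Type*} [AddCommGroup E] [Module ℝ E] (B : E →ₗ[ℝ] E →ₗ[ℝ] ℝ)
    (T : E →ₗ[ℝ] E →ₗ[ℝ] E →ₗ[ℝ] ℝ) {M : ℝ} (hM : 0 ≤ M)
    (hB : ∀ a b, B a b = B b a) (hpos : ∀ a, 0 ≤ B a a)
    (hdef : ∀ a, B a a = 0 → a = 0)
    (hT₁ : ∀ a b c, T a b c = T b a c) (hT₂ : ∀ a b c, T a b c = T a c b)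
    (hT : ∀ a, T a a a ≤ M * Real.sqrt (B a a) ^ 3) (a b : E) :
    T a b b ≤ M * Real.sqrt (B a a) * B b b := by
  -- Normalisation that also covers `b = 0`, with `e = 0`; hence `B e e ≤ 1` instead of equality.
  have unit (b : E) : ∃ (s : ℝ) (e : E), b = s • e ∧ 0 ≤ s ∧ s ^ 2 = B b b ∧ B e e ≤ 1 ∧
      ∀ c, B b c = 0 → B e c = 0 := by
    by_cases hb : b = 0
    · exact ⟨0, 0, by simp [hb]⟩
    have hbp : 0 < B b b := lt_of_le_of_ne (hpos b) (fun h => hb (hdef b h.symm))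
    have hs : 0 < Real.sqrt (B b b) := Real.sqrt_pos.2 hbp
    refine ⟨Real.sqrt (B b b), (Real.sqrt (B b b))⁻¹ • b, ?_, hs.le, Real.sq_sqrt hbp.le, ?_, ?_⟩
    · rw [smul_smul, mul_inv_cancel₀ hs.ne', one_smul]
    · simp only [map_smul, LinearMap.smul_apply, smul_eq_mul]
      nth_rw 3 [← Real.mul_self_sqrt hbp.le]
      field_simp
      rfl
    · intro c hc
      simp [hc]
  by_cases hb : b = 0
  · simp [hb]
  obtain ⟨s, e, hbe, hs, hs2, he, -⟩ := unit b
  have hs0 : s ≠ 0 := by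
    rintro rfl
    exact hb (by simpa using hbe)
  have he1 : B e e = 1 := by
    rw [hbe] at hs2
    simp only [map_smul, LinearMap.smul_apply, smul_eq_mul] at hs2
    have : s ^ 2 * (B e e - 1) = 0 := by linear_combination -hs2
    rcases mul_eq_zero.1 this with h | h
    · exact absurd (pow_eq_zero_iff two_ne_zero |>.1 h) hs0
    · linarith
  -- Gram–Schmidt: `c` is the normalised part of `a` orthogonal to `e`. On the span of `e` and `c`
  -- the form `T` is a binary cubic, and `(α, β)` has Euclidean length `√(B a a)`.
  obtain ⟨β, c, hc, -, hβ2, hc1, hce⟩ := unit (a - B a e • e)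
  have hce0 : B c e = 0 := hce e (by simp [he1])
  have hec0 : B e c = 0 := by rw [hB, hce0]
  obtain ⟨α, hα⟩ : ∃ α, α = B a e := ⟨_, rfl⟩
  rw [← hα] at hc hβ2
  have ha : a = α • e + β • c := by rw [← hc]; abel
  have hnorm : α ^ 2 + β ^ 2 = B a a := by
    rw [hβ2]
    simp only [map_sub, map_smul, LinearMap.sub_apply, LinearMap.smul_apply, smul_eq_mul, he1,
      hB e a, ← hα]
    ring
  have key := cubic_form_polar_le (A := T e e e) (B := T c e e) (C := T c c e) (D := T c c c)
    (M := M) (fun x y hxy => by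
      have h1 := hT (x • e + y • c)
      have h2 : B (x • e + y • c) (x • e + y • c) ≤ 1 := by
        simp only [map_add, map_smul, LinearMap.add_apply, LinearMap.smul_apply, smul_eq_mul, he1,
          hce0, hec0]
        nlinarith [sq_nonneg y]
      have h3 : Real.sqrt (B (x • e + y • c) (x • e + y • c)) ^ 3 ≤ 1 :=
        pow_le_one₀ (Real.sqrt_nonneg _) (Real.sqrt_le_one.2 h2)
      have h4 : T (x • e + y • c) (x • e + y • c) (x • e + y • c)
          = T e e e * x ^ 3 + 3 * T c e e * x ^ 2 * y + 3 * T c c e * x * y ^ 2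
            + T c c c * y ^ 3 := by
        simp only [map_add, map_smul, LinearMap.add_apply, LinearMap.smul_apply, smul_eq_mul]
        rw [hT₁ e c e, hT₁ e c c, hT₂ e e c, hT₁ e c e, hT₂ c e c]
        ring
      rw [← h4]
      nlinarith) α β
  rw [hnorm] at key
  have h5 : T a b b = s ^ 2 * (T e e e * α + T c e e * β) := by
    rw [hbe, ha]
    simp only [map_add, map_smul, LinearMap.add_apply, LinearMap.smul_apply, smul_eq_mul]
    ring
  rw [h5, ← hs2]
  nlinarith [mul_le_mul_of_nonneg_left key (sq_nonneg s)]

end SCOracle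

noncomputable section

namespace SCOracle

/-! ### Self-concordance through Fréchet derivatives: estimates along a segment -/

section NormedSpace

variable {E : Type*} [NormedAddCommGroup E] [NormedSpace ℝ E]

/-- The Hessian of `φ` at `u` as a bilinear form. -/
def hessForm (φ : E → ℝ) (u : E) : E →L[ℝ] E →L[ℝ] ℝ := fderiv ℝ (fderiv ℝ φ) u

/-- The third derivative of `φ` at `u` as a trilinear form. -/
def thirdForm (φ : E → ℝ) (u : E) : E →L[ℝ] E →L[ℝ] E →L[ℝ] ℝ := fderiv ℝ (hessForm φ) u

/-- The local norm of `v` at `u`. -/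
def localNorm (φ : E → ℝ) (u v : E) : ℝ := Real.sqrt (hessForm φ u v v)

/-- Standard self-concordance on an open convex set, in terms of Fréchet derivatives. -/
structure IsSelfConcordantOn (φ : E → ℝ) (D : Set E) : Prop where
  isOpen : IsOpen D
  convex : Convex ℝ D
  contDiffOn : ContDiffOn ℝ 3 φ D
  pos : ∀ u ∈ D, ∀ v, v ≠ 0 → 0 < hessForm φ u v v
  third : ∀ u ∈ D, ∀ v, |thirdForm φ u v v v| ≤ 2 * localNorm φ u v ^ 3

theorem localNorm_nonneg (φ : E → ℝ) (u v : E) : 0 ≤ localNorm φ u v := Real.sqrt_nonneg _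

theorem localNorm_smul (φ : E → ℝ) (u v : E) {t : ℝ} (ht : 0 ≤ t) :
    localNorm φ u (t • v) = t * localNorm φ u v := by
  have : hessForm φ u (t • v) (t • v) = t ^ 2 * hessForm φ u v v := by
    simp only [map_smul, smul_eq_mul, smul_apply]; ring
  rw [localNorm, this, Real.sqrt_mul (sq_nonneg t), Real.sqrt_sq ht, localNorm]

theorem hasFDerivAt_hessForm {φ : E → ℝ} {u : E} (h : ContDiffAt ℝ 3 φ u) :
    HasFDerivAt (fderiv ℝ φ) (hessForm φ u) u :=
  ((h.fderiv_right (m := 2) (by norm_num)).differentiableAt (by norm_num)).hasFDerivAt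

theorem hasFDerivAt_thirdForm {φ : E → ℝ} {u : E} (h : ContDiffAt ℝ 3 φ u) :
    HasFDerivAt (hessForm φ) (thirdForm φ u) u :=
  (((h.fderiv_right (m := 2) (by norm_num)).fderiv_right (m := 1)
    (by norm_num)).differentiableAt (by norm_num)).hasFDerivAt

theorem hessForm_symm {φ : E → ℝ} {u : E} (h : ContDiffAt ℝ 3 φ u) (a b : E) :
    hessForm φ u a b = hessForm φ u b a :=
  (h.isSymmSndFDerivAt (by simp; norm_num)) a b

theorem thirdForm_symm_left {φ : E → ℝ} {u : E} (h : ContDiffAt ℝ 3 φ u) (a b c : E) :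
    thirdForm φ u a b c = thirdForm φ u b a c :=
  congrArg (fun T => T c)
    (((h.fderiv_right (m := 2) (by norm_num)).isSymmSndFDerivAt (by simp)) a b)

theorem thirdForm_symm_right {φ : E → ℝ} {u : E} (h : ContDiffAt ℝ 3 φ u) (a b c : E) :
    thirdForm φ u a b c = thirdForm φ u a c b := by
  have key (b c : E) : HasFDerivAt (fun v => hessForm φ v b c)
      (((thirdForm φ u).flip b).flip c) u := by
    have h1 := (((hasFDerivAt_thirdForm h).clm_apply (hasFDerivAt_const b u))).clm_apply
      (hasFDerivAt_const c u)
    refine h1.congr_fderiv ?_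
    ext a
    simp
  have hev : (fun v => hessForm φ v b c) =ᶠ[nhds u] fun v => hessForm φ v c b := by
    filter_upwards [h.eventually (by simp)] with v hv using hessForm_symm hv b c
  have := (key b c).unique ((key c b).congr_of_eventuallyEq hev)
  exact DFunLike.congr_fun this a

theorem hasDerivAt_fderiv_line {φ : E → ℝ} {u d w : E} {τ : ℝ}
    (h : ContDiffAt ℝ 3 φ (u + τ • d)) :
    HasDerivAt (fun t : ℝ => fderiv ℝ φ (u + t • d) w) (hessForm φ (u + τ • d) d w) τ := by
  have hl : HasDerivAt (fun t : ℝ => u + t • d) d τ := by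
    simpa using ((hasDerivAt_id τ).smul_const d).const_add u
  have h1 := (hasFDerivAt_hessForm h).comp_hasDerivAt τ hl
  exact (ContinuousLinearMap.apply ℝ ℝ w).hasFDerivAt.comp_hasDerivAt τ h1

theorem hasDerivAt_hessForm_line {φ : E → ℝ} {u d w : E} {τ : ℝ}
    (h : ContDiffAt ℝ 3 φ (u + τ • d)) :
    HasDerivAt (fun t : ℝ => hessForm φ (u + t • d) w w) (thirdForm φ (u + τ • d) d w w) τ := by
  have hl : HasDerivAt (fun t : ℝ => u + t • d) d τ := by
    simpa using ((hasDerivAt_id τ).smul_const d).const_add u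
  have h1 : HasDerivAt (fun t : ℝ => hessForm φ (u + t • d)) (thirdForm φ (u + τ • d) d) τ :=
    HasFDerivAt.comp_hasDerivAt τ (l := hessForm φ) (hasFDerivAt_thirdForm h) hl
  simpa using (h1.clm_apply (hasDerivAt_const τ w)).clm_apply (hasDerivAt_const τ w)

theorem hasDerivAt_line {φ : E → ℝ} {u d : E} {τ : ℝ}
    (h : ContDiffAt ℝ 3 φ (u + τ • d)) :
    HasDerivAt (fun t : ℝ => φ (u + t • d)) (fderiv ℝ φ (u + τ • d) d) τ := by
  have hl : HasDerivAt (fun t : ℝ => u + t • d) d τ := by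
    simpa using ((hasDerivAt_id τ).smul_const d).const_add u
  exact (h.differentiableAt (by norm_num)).hasFDerivAt.comp_hasDerivAt τ hl

/-- The fundamental estimate for positive functions with `|g'| ≤ 2 g^{3/2}`. -/
theorem sqrt_bounds_of_abs_deriv_le {g g' : ℝ → ℝ}
    (hg : ∀ τ ∈ Set.Icc (0 : ℝ) 1, HasDerivAt g (g' τ) τ) (hpos : ∀ τ ∈ Set.Icc (0 : ℝ) 1, 0 < g τ)
    (hb : ∀ τ ∈ Set.Icc (0 : ℝ) 1, |g' τ| ≤ 2 * Real.sqrt (g τ) ^ 3)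
    {τ : ℝ} (hτ : τ ∈ Set.Icc (0 : ℝ) 1) :
    Real.sqrt (g 0) ≤ Real.sqrt (g τ) * (1 + Real.sqrt (g 0) * τ) ∧
      Real.sqrt (g τ) * (1 - Real.sqrt (g 0) * τ) ≤ Real.sqrt (g 0) := by
  -- The hypothesis says exactly that `g^(-1/2)` is 1-Lipschitz. Both conclusions are this Lipschitz
  -- bound multiplied by `√(g 0) √(g τ)`.
  have hd (t : ℝ) (ht : t ∈ Set.Icc (0 : ℝ) 1) :
      HasDerivAt (fun s => (Real.sqrt (g s))⁻¹) (-(g' t / (2 * Real.sqrt (g t))) /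
        Real.sqrt (g t) ^ 2) t :=
    ((hg t ht).sqrt (hpos t ht).ne').inv (Real.sqrt_pos.2 (hpos t ht)).ne'
  have hd1 (t : ℝ) (ht : t ∈ Set.Icc (0 : ℝ) 1) :
      |-(g' t / (2 * Real.sqrt (g t))) / Real.sqrt (g t) ^ 2| ≤ 1 := by
    have hs := Real.sqrt_pos.2 (hpos t ht)
    have : -(g' t / (2 * Real.sqrt (g t))) / Real.sqrt (g t) ^ 2
        = -(g' t / (2 * Real.sqrt (g t) ^ 3)) := by field_simp
    rw [this, abs_neg, abs_div, abs_of_pos (by positivity : 0 < 2 * Real.sqrt (g t) ^ 3),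
      div_le_one (by positivity)]
    exact hb t ht
  have hlip := Convex.norm_image_sub_le_of_norm_hasDerivWithin_le (C := 1)
    (fun t ht => (hd t ht).hasDerivWithinAt) (fun t ht => hd1 t ht) (convex_Icc (0 : ℝ) 1)
    (Set.left_mem_Icc.2 zero_le_one) hτ
  rw [Real.norm_eq_abs, Real.norm_eq_abs, sub_zero, abs_of_nonneg hτ.1, one_mul, abs_le] at hlip
  have h0 := Real.sqrt_pos.2 (hpos 0 (Set.left_mem_Icc.2 zero_le_one))
  have h1 := Real.sqrt_pos.2 (hpos τ hτ)
  set r := Real.sqrt (g 0)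
  set q := Real.sqrt (g τ)
  have e1 : r * q * (q⁻¹ - r⁻¹) = r - q := by field_simp
  have hrq := mul_pos h0 h1
  constructor
  · nlinarith [mul_le_mul_of_nonneg_left hlip.2 hrq.le]
  · nlinarith [mul_le_mul_of_nonneg_left hlip.1 hrq.le]

theorem le_of_hasDerivAt_le {f g f' g' : ℝ → ℝ} (h0 : f 0 ≤ g 0)
    (hf : ∀ τ ∈ Set.Icc (0 : ℝ) 1, HasDerivAt f (f' τ) τ)
    (hg : ∀ τ ∈ Set.Icc (0 : ℝ) 1, HasDerivAt g (g' τ) τ)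
    (h : ∀ τ ∈ Set.Icc (0 : ℝ) 1, f' τ ≤ g' τ) {τ : ℝ} (hτ : τ ∈ Set.Icc (0 : ℝ) 1) :
    f τ ≤ g τ := by
  have hd (t : ℝ) (ht : t ∈ Set.Icc (0 : ℝ) 1) := (hg t ht).sub (hf t ht)
  have hm : MonotoneOn (g - f) (Set.Icc (0 : ℝ) 1) := by
    refine monotoneOn_of_deriv_nonneg (convex_Icc 0 1)
      (fun t ht => (hd t ht).continuousAt.continuousWithinAt)
      (fun t ht => (hd t (interior_subset ht)).differentiableAt.differentiableWithinAt)
      (fun t ht => ?_)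
    rw [(hd t (interior_subset ht)).deriv]
    linarith [h t (interior_subset ht)]
  have := hm (Set.left_mem_Icc.2 zero_le_one) hτ hτ.1
  simp only [Pi.sub_apply] at this
  linarith

namespace IsSelfConcordantOn

variable {φ : E → ℝ} {D : Set E} (hφ : IsSelfConcordantOn φ D)
include hφ

theorem contDiffAt {u : E} (hu : u ∈ D) : ContDiffAt ℝ 3 φ u :=
  hφ.contDiffOn.contDiffAt (hφ.isOpen.mem_nhds hu)

theorem hessForm_nonneg {u : E} (hu : u ∈ D) (v : E) : 0 ≤ hessForm φ u v v := by
  by_cases hv : v = 0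
  · simp [hv]
  · exact (hφ.pos u hu v hv).le

theorem localNorm_sq {u : E} (hu : u ∈ D) (v : E) : localNorm φ u v ^ 2 = hessForm φ u v v :=
  Real.sq_sqrt (hφ.hessForm_nonneg hu v)

/-- The definition bounds the third derivative on the diagonal only. The mixed form is needed when
the Hessian is tested on a vector other than the direction of motion; it comes from `trilinear_le`,
and the lower bound from `a ↦ -a`. -/
theorem abs_thirdForm_le {u : E} (hu : u ∈ D) (a b : E) :
    |thirdForm φ u a b b| ≤ 2 * localNorm φ u a * hessForm φ u b b := by
  have hc := hφ.contDiffAt hu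
  have key (a : E) : thirdForm φ u a b b ≤ 2 * localNorm φ u a * hessForm φ u b b := by
    let B : E →ₗ[ℝ] E →ₗ[ℝ] ℝ := ContinuousLinearMap.coeLM ℝ ∘ₗ (hessForm φ u).toLinearMap
    let T : E →ₗ[ℝ] E →ₗ[ℝ] E →ₗ[ℝ] ℝ :=
      (LinearMap.compRight ℝ (ContinuousLinearMap.coeLM ℝ : (E →L[ℝ] ℝ) →ₗ[ℝ] E →ₗ[ℝ] ℝ)) ∘ₗ
        ContinuousLinearMap.coeLM ℝ ∘ₗ (thirdForm φ u).toLinearMap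
    refine trilinear_le B T zero_le_two (hessForm_symm hc) (hφ.hessForm_nonneg hu) (fun a ha => ?_)
      (thirdForm_symm_left hc) (thirdForm_symm_right hc)
      (fun a => (abs_le.1 (hφ.third u hu a)).2) a b
    by_contra h
    exact (hφ.pos u hu a h).ne' ha
  rw [abs_le]
  refine ⟨?_, key a⟩
  have := key (-a)
  have h2 : localNorm φ u (-a) = localNorm φ u a := by simp [localNorm]
  rw [h2] at this
  simp only [map_neg, neg_apply] at this
  linarith

theorem line_mem {u v : E} (hu : u ∈ D) (hv : v ∈ D) {τ : ℝ} (hτ : τ ∈ Set.Icc (0 : ℝ) 1) :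
    u + τ • (v - u) ∈ D :=
  hφ.convex.add_smul_sub_mem hu hv hτ

theorem localNorm_line {u v : E} (hu : u ∈ D) (hv : v ∈ D) {τ : ℝ} (hτ : τ ∈ Set.Icc (0 : ℝ) 1) :
    localNorm φ u (v - u)
        ≤ localNorm φ (u + τ • (v - u)) (v - u) * (1 + localNorm φ u (v - u) * τ) ∧
      localNorm φ (u + τ • (v - u)) (v - u) * (1 - localNorm φ u (v - u) * τ)
        ≤ localNorm φ u (v - u) := by
  by_cases huv : v - u = 0
  · simp [huv, localNorm]
  have hm (t : ℝ) (ht : t ∈ Set.Icc (0 : ℝ) 1) := hφ.line_mem hu hv ht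
  have := sqrt_bounds_of_abs_deriv_le
    (g := fun t => hessForm φ (u + t • (v - u)) (v - u) (v - u))
    (fun t ht => hasDerivAt_hessForm_line (hφ.contDiffAt (hm t ht)))
    (fun t ht => hφ.pos _ (hm t ht) _ huv)
    (fun t ht => hφ.third _ (hm t ht) _) hτ
  simpa [localNorm] using this

/-- Lower bound on the growth of the gradient along a segment. -/
theorem fderiv_sub_ge {u v : E} (hu : u ∈ D) (hv : v ∈ D) {τ : ℝ} (hτ : τ ∈ Set.Icc (0 : ℝ) 1) :
    localNorm φ u (v - u) - localNorm φ u (v - u) / (1 + localNorm φ u (v - u) * τ)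
      ≤ fderiv ℝ φ (u + τ • (v - u)) (v - u) - fderiv ℝ φ u (v - u) := by
  set r := localNorm φ u (v - u)
  have hr0 : 0 ≤ r := localNorm_nonneg _ _ _
  have hm (t : ℝ) (ht : t ∈ Set.Icc (0 : ℝ) 1) := hφ.line_mem hu hv ht
  have hp (t : ℝ) (ht : t ∈ Set.Icc (0 : ℝ) 1) : 0 < 1 + r * t := by
    have := mul_nonneg hr0 ht.1; linarith
  refine le_of_hasDerivAt_le (f := fun t => r - r / (1 + r * t))
    (g := fun t => fderiv ℝ φ (u + t • (v - u)) (v - u) - fderiv ℝ φ u (v - u))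
    (f' := fun t => (r / (1 + r * t)) ^ 2) (by simp) (fun t ht => ?_)
    (fun t ht => (hasDerivAt_fderiv_line (hφ.contDiffAt (hm t ht))).sub_const _) (fun t ht => ?_) hτ
  · have h1 : HasDerivAt (fun t => 1 + r * t) r t := by
      simpa using ((hasDerivAt_id t).const_mul r).const_add 1
    have h2 := ((h1.inv (hp t ht).ne').const_mul r).const_sub r
    simp only [div_eq_mul_inv r]
    exact h2.congr_deriv (by field_simp)
  · rw [← hφ.localNorm_sq (hm t ht)]
    refine pow_le_pow_left₀ (div_nonneg hr0 (hp t ht).le) ?_ 2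
    rw [div_le_iff₀ (hp t ht)]
    exact (hφ.localNorm_line hu hv ht).1

theorem fderiv_sub_le {u v : E} (hu : u ∈ D) (hv : v ∈ D) (h1 : localNorm φ u (v - u) < 1) {τ : ℝ}
    (hτ : τ ∈ Set.Icc (0 : ℝ) 1) :
    fderiv ℝ φ (u + τ • (v - u)) (v - u) - fderiv ℝ φ u (v - u)
      ≤ localNorm φ u (v - u) / (1 - localNorm φ u (v - u) * τ) - localNorm φ u (v - u) := by
  set r := localNorm φ u (v - u)
  have hr0 : 0 ≤ r := localNorm_nonneg _ _ _
  have hm (t : ℝ) (ht : t ∈ Set.Icc (0 : ℝ) 1) := hφ.line_mem hu hv ht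
  have hp (t : ℝ) (ht : t ∈ Set.Icc (0 : ℝ) 1) : 0 < 1 - r * t := by
    have := mul_le_mul_of_nonneg_left ht.2 hr0; linarith
  refine le_of_hasDerivAt_le (g := fun t => r / (1 - r * t) - r)
    (f := fun t => fderiv ℝ φ (u + t • (v - u)) (v - u) - fderiv ℝ φ u (v - u))
    (g' := fun t => (r / (1 - r * t)) ^ 2) (by simp)
    (fun t ht => (hasDerivAt_fderiv_line (hφ.contDiffAt (hm t ht))).sub_const _)
    (fun t ht => ?_) (fun t ht => ?_) hτ
  · have h1 : HasDerivAt (fun t => 1 - r * t) (-r) t := by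
      simpa using ((hasDerivAt_id t).const_mul r).const_sub 1
    have h2 := ((h1.inv (hp t ht).ne').const_mul r).sub_const r
    simp only [div_eq_mul_inv r]
    exact h2.congr_deriv (by field_simp)
  · rw [← hφ.localNorm_sq (hm t ht)]
    refine pow_le_pow_left₀ (localNorm_nonneg _ _ _) ?_ 2
    rw [le_div_iff₀ (hp t ht)]
    exact (hφ.localNorm_line hu hv ht).2

/-- Integrating `fderiv_sub_ge` over the segment turns `r - r/(1 + r t)` into `ω(r)`; `le_omegaStar`
is the counterpart for the upper gradient estimate. -/
theorem omega_le {u v : E} (hu : u ∈ D) (hv : v ∈ D) :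
    φ u + fderiv ℝ φ u (v - u) + omega (localNorm φ u (v - u)) ≤ φ v := by
  set r := localNorm φ u (v - u)
  have hr0 : 0 ≤ r := localNorm_nonneg _ _ _
  have hm (t : ℝ) (ht : t ∈ Set.Icc (0 : ℝ) 1) := hφ.line_mem hu hv ht
  have hp (t : ℝ) (ht : t ∈ Set.Icc (0 : ℝ) 1) : 0 < 1 + r * t := by
    have := mul_nonneg hr0 ht.1; linarith
  have := le_of_hasDerivAt_le
    (f := fun t => r * t - Real.log (1 + r * t) + fderiv ℝ φ u (v - u) * t + φ u)
    (g := fun t => φ (u + t • (v - u)))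
    (f' := fun t => r - r / (1 + r * t) + fderiv ℝ φ u (v - u)) (by simp) (fun t ht => ?_)
    (fun t ht => hasDerivAt_line (hφ.contDiffAt (hm t ht))) (fun t ht => ?_)
    (Set.right_mem_Icc.2 zero_le_one)
  · simp only [mul_one, one_smul, add_sub_cancel] at this
    rw [omega]
    linarith
  · have h0 : HasDerivAt (fun t => r * t) r t := by
      simpa using (hasDerivAt_id t).const_mul r
    have h1 := (h0.const_add 1).log (hp t ht).ne'
    have h2 := (hasDerivAt_id t).const_mul (fderiv ℝ φ u (v - u))
    rw [mul_one] at h2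
    exact ((h0.sub h1).add h2).add_const _
  · linarith [hφ.fderiv_sub_ge hu hv ht]

theorem le_omegaStar {u v : E} (hu : u ∈ D) (hv : v ∈ D) (h1 : localNorm φ u (v - u) < 1) :
    φ v ≤ φ u + fderiv ℝ φ u (v - u) + omegaStar (localNorm φ u (v - u)) := by
  set r := localNorm φ u (v - u)
  have hr0 : 0 ≤ r := localNorm_nonneg _ _ _
  have hm (t : ℝ) (ht : t ∈ Set.Icc (0 : ℝ) 1) := hφ.line_mem hu hv ht
  have hp (t : ℝ) (ht : t ∈ Set.Icc (0 : ℝ) 1) : 0 < 1 - r * t := by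
    have := mul_le_mul_of_nonneg_left ht.2 hr0; linarith
  have := le_of_hasDerivAt_le
    (g := fun t => fderiv ℝ φ u (v - u) * t - r * t - Real.log (1 - r * t) + φ u)
    (f := fun t => φ (u + t • (v - u)))
    (g' := fun t => fderiv ℝ φ u (v - u) - r - (-r) / (1 - r * t)) (by simp)
    (fun t ht => hasDerivAt_line (hφ.contDiffAt (hm t ht))) (fun t ht => ?_) (fun t ht => ?_)
    (Set.right_mem_Icc.2 zero_le_one)
  · simp only [mul_one, one_smul, add_sub_cancel] at this
    rw [omegaStar]
    linarith
  · have h0 : HasDerivAt (fun t => r * t) r t := by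
      simpa using (hasDerivAt_id t).const_mul r
    have h1 := (h0.const_sub 1).log (hp t ht).ne'
    have h2 := (hasDerivAt_id t).const_mul (fderiv ℝ φ u (v - u))
    rw [mul_one] at h2
    exact ((h2.sub h0).sub h1).add_const _
  · rw [neg_div]
    linarith [hφ.fderiv_sub_le hu hv h1 ht]

/-- Along the segment `h(t) = D²φ[w, w]` satisfies `(1 - r t)|h'| ≤ 2 r h`, so `h (1 - r t)²` is
nonincreasing and `h / (1 - r t)²` is nondecreasing. The two bounds compare the endpoints. -/
theorem hessForm_comparison {u v : E} (hu : u ∈ D) (hv : v ∈ D) (h1 : localNorm φ u (v - u) < 1)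
    (w : E) :
    (1 - localNorm φ u (v - u)) ^ 2 * hessForm φ v w w ≤ hessForm φ u w w ∧
      (1 - localNorm φ u (v - u)) ^ 2 * hessForm φ u w w ≤ hessForm φ v w w := by
  set r := localNorm φ u (v - u)
  have hr0 : 0 ≤ r := localNorm_nonneg _ _ _
  have hm (t : ℝ) (ht : t ∈ Set.Icc (0 : ℝ) 1) := hφ.line_mem hu hv ht
  have hp (t : ℝ) (ht : t ∈ Set.Icc (0 : ℝ) 1) : 0 < 1 - r * t := by
    have := mul_le_mul_of_nonneg_left ht.2 hr0; linarith
  have hd (t : ℝ) (ht : t ∈ Set.Icc (0 : ℝ) 1) :=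
    hasDerivAt_hessForm_line (w := w) (hφ.contDiffAt (hm t ht))
  have hl (t : ℝ) : HasDerivAt (fun t => (1 - r * t) ^ 2) (-2 * r * (1 - r * t)) t := by
    have h := (((hasDerivAt_id t).const_mul r).const_sub 1).pow 2
    exact h.congr_deriv (by simp; ring)
  have hb (t : ℝ) (ht : t ∈ Set.Icc (0 : ℝ) 1) :
      |thirdForm φ (u + t • (v - u)) (v - u) w w| * (1 - r * t)
        ≤ 2 * r * hessForm φ (u + t • (v - u)) w w := by
    have h1 := mul_le_mul_of_nonneg_right (hφ.abs_thirdForm_le (hm t ht) (v - u) w) (hp t ht).le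
    have h2 := mul_le_mul_of_nonneg_right (hφ.localNorm_line hu hv ht).2
      (hφ.hessForm_nonneg (hm t ht) w)
    linarith
  constructor
  · have := le_of_hasDerivAt_le
      (f := fun t => hessForm φ (u + t • (v - u)) w w * (1 - r * t) ^ 2)
      (g := fun _ => hessForm φ u w w) (g' := fun _ => 0) (by simp)
      (fun t ht => (hd t ht).mul (hl t)) (fun t _ => hasDerivAt_const t _) (fun t ht => ?_)
      (Set.right_mem_Icc.2 zero_le_one)
    · simp only [mul_one, one_smul, add_sub_cancel] at this
      linarith
    · have h3 := mul_le_mul_of_nonneg_right (hb t ht) (hp t ht).le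
      have h4 := mul_le_mul_of_nonneg_right
        (le_abs_self (thirdForm φ (u + t • (v - u)) (v - u) w w)) (sq_nonneg (1 - r * t))
      linarith
  · have := le_of_hasDerivAt_le
      (f := fun _ => hessForm φ u w w)
      (g := fun t => hessForm φ (u + t • (v - u)) w w / (1 - r * t) ^ 2)
      (f' := fun _ => 0) (by simp) (fun t _ => hasDerivAt_const t _)
      (fun t ht => (hd t ht).div (hl t) (pow_pos (hp t ht) 2).ne') (fun t ht => ?_)
      (Set.right_mem_Icc.2 zero_le_one)
    · simp only [mul_one, one_smul, add_sub_cancel] at this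
      rw [le_div_iff₀ (by nlinarith : 0 < (1 - r) ^ 2)] at this
      linarith
    · refine div_nonneg ?_ (by positivity)
      have h3 := mul_le_mul_of_nonneg_right (hb t ht) (hp t ht).le
      have h4 := mul_le_mul_of_nonneg_right
        (neg_abs_le (thirdForm φ (u + t • (v - u)) (v - u) w w)) (sq_nonneg (1 - r * t))
      linarith

end IsSelfConcordantOn

end NormedSpace

/-! ### The Dikin ellipsoid, and existence and location of minimisers -/

namespace IsSelfConcordantOn

variable {E : Type*} [NormedAddCommGroup E] [NormedSpace ℝ E] {φ : E → ℝ} {D : Set E}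
  (hφ : IsSelfConcordantOn φ D)
include hφ

/-- The open Dikin ellipsoid is contained in the domain of a closed self-concordant function. -/
theorem mem_of_localNorm_lt_one (hcl : IsClosed {q : E × ℝ | q.1 ∈ D ∧ φ q.1 ≤ q.2})
    {u v : E} (hu : u ∈ D) (h1 : localNorm φ u (v - u) < 1) : v ∈ D := by
  set r := localNorm φ u (v - u)
  have hr0 : 0 ≤ r := localNorm_nonneg _ _ _
  set M := φ u + |fderiv ℝ φ u (v - u)| + omegaStar r
  let s : Set ℝ := {t | u + t • (v - u) ∈ D}
  have hcont : Continuous fun t : ℝ => u + t • (v - u) := by fun_prop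
  have hopen : IsOpen s := hφ.isOpen.preimage hcont
  have hbound : ∀ t ∈ s ∩ Set.Icc 0 1, φ (u + t • (v - u)) ≤ M := by
    rintro t ⟨ht, ht0, ht1⟩
    have e : u + t • (v - u) - u = t • (v - u) := by abel
    have e2 : localNorm φ u (u + t • (v - u) - u) = t * r := by rw [e, localNorm_smul _ _ _ ht0]
    have hle : t * r ≤ r := by nlinarith
    have := hφ.le_omegaStar hu ht (by rw [e2]; linarith)
    rw [e2, e, map_smul, smul_eq_mul] at this
    have h3 := omegaStar_mono (mul_nonneg ht0 hr0) hle h1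
    have h4 : t * fderiv ℝ φ u (v - u) ≤ |fderiv ℝ φ u (v - u)| := by
      nlinarith [le_abs_self (fderiv ℝ φ u (v - u)), abs_nonneg (fderiv ℝ φ u (v - u))]
    linarith
  -- On the part of the segment inside `D`, `φ` is at most `M`, so these parameters form the
  -- preimage of the closed epigraph at height `M`. They are also relatively open, hence fill `[0,
  -- 1]`.
  have hclosed : IsClosed (s ∩ Set.Icc 0 1) := by
    have : s ∩ Set.Icc 0 1 = (fun t : ℝ => (u + t • (v - u), M)) ⁻¹'
        {q : E × ℝ | q.1 ∈ D ∧ φ q.1 ≤ q.2} ∩ Set.Icc 0 1 := by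
      ext t
      exact ⟨fun h => ⟨⟨h.1, hbound t h⟩, h.2⟩, fun h => ⟨h.1.1, h.2⟩⟩
    rw [this]
    exact (hcl.preimage (by fun_prop)).inter isClosed_Icc
  have hsub := hclosed.Icc_subset_of_forall_exists_gt (by simpa [s] using hu)
    (fun t ht y hy => by
      have hy : t < y := hy
      have h1 : ∀ᶠ z in nhdsWithin t (Set.Ioi t), z ∈ s :=
        mem_nhdsWithin_of_mem_nhds (hopen.mem_nhds ht.1)
      have h2 : ∀ᶠ z in nhdsWithin t (Set.Ioi t), z ∈ Set.Ioc t y := Ioc_mem_nhdsGT hy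
      obtain ⟨z, hz⟩ := (h1.and h2).exists
      exact ⟨z, hz⟩)
  have := hsub (Set.right_mem_Icc.2 zero_le_one)
  simpa [s] using this

theorem exists_norm_le_localNorm [FiniteDimensional ℝ E] {u : E} (hu : u ∈ D) :
    ∃ c : ℝ, 0 < c ∧ ∀ w, c * ‖w‖ ≤ localNorm φ u w := by
  rcases subsingleton_or_nontrivial E with hE | hE
  · exact ⟨1, one_pos, fun w => by simp [Subsingleton.elim w 0, localNorm]⟩
  have hcont : Continuous (localNorm φ u) := by
    unfold localNorm
    fun_prop
  have : ProperSpace E := FiniteDimensional.proper ℝ E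
  obtain ⟨z, hz, hmin⟩ := (isCompact_sphere (0 : E) 1).exists_isMinOn
    (NormedSpace.sphere_nonempty.2 zero_le_one) hcont.continuousOn
  have hz0 : z ≠ 0 := ne_zero_of_mem_unit_sphere ⟨z, hz⟩
  refine ⟨localNorm φ u z, Real.sqrt_pos.2 (hφ.pos u hu z hz0), fun w => ?_⟩
  by_cases hw : w = 0
  · simp [hw, localNorm]
  have hw' : 0 < ‖w‖ := norm_pos_iff.2 hw
  have h1 : localNorm φ u z ≤ localNorm φ u (‖w‖⁻¹ • w) :=
    hmin (by simp [norm_smul, hw'.ne'])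
  rw [localNorm_smul _ _ _ (inv_nonneg.2 hw'.le), inv_mul_eq_div, le_div_iff₀ hw'] at h1
  exact h1

theorem fderiv_eq_of_isMinOn {v : E} (hv : v ∈ D) (ℓ : E →L[ℝ] ℝ)
    (hmin : ∀ w ∈ D, φ v - ℓ v ≤ φ w - ℓ w) : fderiv ℝ φ v = ℓ := by
  have hloc : IsLocalMin (fun w => φ w - ℓ w) v := by
    filter_upwards [hφ.isOpen.mem_nhds hv] with w hw using hmin w hw
  have hd := ((hφ.contDiffAt hv).differentiableAt (by norm_num)).hasFDerivAt.sub ℓ.hasFDerivAt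
  exact sub_eq_zero.1 (hloc.hasFDerivAt_eq_zero hd)

theorem isMinOn_of_fderiv_eq {v : E} (hv : v ∈ D) (ℓ : E →L[ℝ] ℝ) (h : fderiv ℝ φ v = ℓ) :
    ∀ w ∈ D, φ v - ℓ v ≤ φ w - ℓ w := by
  intro w hw
  have h1 := hφ.omega_le hv hw
  have h2 := omega_nonneg (localNorm_nonneg φ v (w - v))
  rw [h, map_sub] at h1
  linarith

/-- With `r` the distance from `u` to the minimiser, the gradient grows by at least `r²/(1 + r)`
along the segment, while the decrement allows at most `lam * r`. Hence `r/(1 + r) ≤ lam`. -/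
theorem localNorm_le_of_isMinOn {u v : E} (hu : u ∈ D) (hv : v ∈ D) (ℓ : E →L[ℝ] ℝ) {lam : ℝ}
    (h0 : 0 ≤ lam) (h1 : lam < 1)
    (hlam : ∀ w, |fderiv ℝ φ u w - ℓ w| ≤ lam * localNorm φ u w)
    (hmin : ∀ w ∈ D, φ v - ℓ v ≤ φ w - ℓ w) :
    localNorm φ u (v - u) ≤ lam / (1 - lam) := by
  have h2 := hφ.fderiv_sub_ge hu hv (Set.right_mem_Icc.2 zero_le_one)
  rw [one_smul, add_sub_cancel, hφ.fderiv_eq_of_isMinOn hv ℓ hmin, mul_one] at h2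
  have h3 := (abs_le.1 (hlam (v - u))).1
  have hr := localNorm_nonneg φ u (v - u)
  set r := localNorm φ u (v - u)
  have h4 : r - r / (1 + r) = r / (1 + r) * r := by field_simp; ring
  rw [h4] at h2
  rw [le_div_iff₀ (by linarith)]
  rcases hr.eq_or_lt with h | h
  · rw [← h]
    linarith
  · have h5 : r / (1 + r) ≤ lam := le_of_mul_le_mul_right (by linarith) h
    rw [div_le_iff₀ (by linarith)] at h5
    linarith

/-- On the sublevel set of `φ - ℓ` through `u`, `ω(r) ≤ lam * r` with `lam < 1`, which bounds `r`.
Closedness of the epigraph makes the set closed, hence compact. -/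
theorem exists_isMinOn [FiniteDimensional ℝ E]
    (hcl : IsClosed {q : E × ℝ | q.1 ∈ D ∧ φ q.1 ≤ q.2}) {u : E} (hu : u ∈ D) (ℓ : E →L[ℝ] ℝ)
    {lam : ℝ} (h1 : lam < 1) (hlam : ∀ w, |fderiv ℝ φ u w - ℓ w| ≤ lam * localNorm φ u w) :
    ∃ v ∈ D, ∀ w ∈ D, φ v - ℓ v ≤ φ w - ℓ w := by
  let K : Set E := {v | v ∈ D ∧ φ v ≤ φ u - ℓ u + ℓ v}
  have hKcl : IsClosed K :=
    hcl.preimage (f := fun v : E => (v, φ u - ℓ u + ℓ v)) (by fun_prop)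
  obtain ⟨c, hc, hcn⟩ := hφ.exists_norm_le_localNorm hu
  -- With `lam = 1 - 2ε`, the sublevel inequality gives `2ε r ≤ log(1 + r)`. Bounding the logarithm
  -- by `ε(1 + r) - 1 - log ε` leaves `ε r ≤ ε - 1 - log ε`, the radius used below.
  obtain ⟨ε, hε⟩ : ∃ ε, ε = (1 - lam) / 2 := ⟨_, rfl⟩
  have hε0 : 0 < ε := by linarith
  have hKb : K ⊆ Metric.closedBall u ((ε - 1 - Real.log ε) / ε / c) := by
    rintro v ⟨hv, hle⟩
    have h2 := hφ.omega_le hu hv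
    have h3 := (abs_le.1 (hlam (v - u))).1
    have hr := localNorm_nonneg φ u (v - u)
    have h5 := hcn (v - u)
    rw [map_sub ℓ] at h3
    set r := localNorm φ u (v - u)
    have h4 := Real.log_le_sub_one_of_pos (mul_pos hε0 (by linarith : 0 < 1 + r))
    rw [Real.log_mul hε0.ne' (by linarith)] at h4
    rw [mem_closedBall_iff_norm, le_div_iff₀ hc, le_div_iff₀ hε0]
    rw [omega] at h2
    have h6 : lam = 1 - 2 * ε := by linarith
    rw [h6] at h3
    nlinarith
  have : ProperSpace E := FiniteDimensional.proper ℝ E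
  have hK : IsCompact K := (isCompact_closedBall _ _).of_isClosed_subset hKcl hKb
  have huK : u ∈ K := ⟨hu, by simp⟩
  obtain ⟨v, hv, hmin⟩ := hK.exists_isMinOn (f := fun v => φ v - ℓ v) ⟨u, huK⟩
    (fun w hw => (((hφ.contDiffAt hw.1).continuousAt).sub
      ℓ.continuous.continuousAt).continuousWithinAt)
  refine ⟨v, hv.1, fun w hw => ?_⟩
  by_cases hwK : w ∈ K
  · exact hmin hwK
  · have h2 : ¬ φ w ≤ φ u - ℓ u + ℓ w := fun h => hwK ⟨hw, h⟩
    have h3 := hv.2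
    linarith

end IsSelfConcordantOn

/-! ### Quadratic forms of positive definite matrices, and the passage from coordinates to Fréchet
derivatives -/

section Matrix

variable {n p : ℕ}

theorem dotProduct_mulVec_comm {P : Matrix (Fin n) (Fin n) ℝ} (hP : P.PosDef) (v w : Fin n → ℝ) :
    v ⬝ᵥ (P *ᵥ w) = w ⬝ᵥ (P *ᵥ v) := by
  have h : Pᵀ = P := hP.isHermitian
  rw [Matrix.dotProduct_mulVec, ← Matrix.mulVec_transpose, h, dotProduct_comm]

theorem dotProduct_mulVec_self_nonneg {P : Matrix (Fin n) (Fin n) ℝ} (hP : P.PosDef)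
    (v : Fin n → ℝ) : 0 ≤ v ⬝ᵥ (P *ᵥ v) := by
  simpa using hP.posSemidef.dotProduct_mulVec_nonneg v

theorem wnorm_nonneg (P : Matrix (Fin n) (Fin n) ℝ) (v : Fin n → ℝ) : 0 ≤ wnorm P v :=
  Real.sqrt_nonneg _

theorem wnorm_sq {P : Matrix (Fin n) (Fin n) ℝ} (hP : P.PosDef) (v : Fin n → ℝ) :
    wnorm P v ^ 2 = v ⬝ᵥ (P *ᵥ v) :=
  Real.sq_sqrt (dotProduct_mulVec_self_nonneg hP v)

theorem mulVec_mulVec_inv {P : Matrix (Fin n) (Fin n) ℝ} (hP : P.PosDef) (w : Fin n → ℝ) :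
    P *ᵥ (P⁻¹ *ᵥ w) = w := by
  rw [Matrix.mulVec_mulVec, Matrix.mul_nonsing_inv _ ((Matrix.isUnit_iff_isUnit_det P).1 hP.isUnit),
    Matrix.one_mulVec]

theorem inv_mulVec_mulVec {P : Matrix (Fin n) (Fin n) ℝ} (hP : P.PosDef) (w : Fin n → ℝ) :
    P⁻¹ *ᵥ (P *ᵥ w) = w := by
  rw [Matrix.mulVec_mulVec, Matrix.nonsing_inv_mul _ ((Matrix.isUnit_iff_isUnit_det P).1 hP.isUnit),
    Matrix.one_mulVec]

theorem dotProduct_mulVec_sq_le {P : Matrix (Fin n) (Fin n) ℝ} (hP : P.PosDef)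
    (v w : Fin n → ℝ) : (v ⬝ᵥ (P *ᵥ w)) ^ 2 ≤ (v ⬝ᵥ (P *ᵥ v)) * (w ⬝ᵥ (P *ᵥ w)) := by
  have := LinearMap.BilinForm.apply_mul_apply_le_of_forall_zero_le (Matrix.toLinearMap₂' ℝ P)
    (fun v => by rw [Matrix.toLinearMap₂'_apply']; exact dotProduct_mulVec_self_nonneg hP v) v w
  simp only [Matrix.toLinearMap₂'_apply'] at this
  rw [dotProduct_mulVec_comm hP w v] at this
  rw [sq]
  exact this

theorem abs_dotProduct_le {P : Matrix (Fin n) (Fin n) ℝ} (hP : P.PosDef) (v w : Fin n → ℝ) :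
    |v ⬝ᵥ w| ≤ wnorm P v * wnorm P⁻¹ w := by
  have h := dotProduct_mulVec_sq_le hP v (P⁻¹ *ᵥ w)
  rw [mulVec_mulVec_inv hP, ← wnorm_sq hP, dotProduct_comm (P⁻¹ *ᵥ w), ← wnorm_sq hP.inv,
    ← mul_pow] at h
  exact abs_le_of_sq_le_sq h (mul_nonneg (wnorm_nonneg _ _) (wnorm_nonneg _ _))

/-- Inversion reverses the Loewner order. -/
theorem inv_form_le {P Q : Matrix (Fin n) (Fin n) ℝ} (hP : P.PosDef) (hQ : Q.PosDef) {c : ℝ}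
    (h : ∀ v, c * (v ⬝ᵥ (P *ᵥ v)) ≤ v ⬝ᵥ (Q *ᵥ v)) (w : Fin n → ℝ) :
    c * (w ⬝ᵥ (Q⁻¹ *ᵥ w)) ≤ w ⬝ᵥ (P⁻¹ *ᵥ w) := by
  -- Cauchy–Schwarz in `P` between `Q⁻¹w` and `P⁻¹w`; combined with `h` at `Q⁻¹w` it gives `c a² ≤ a
  -- b`.
  have h1 := dotProduct_mulVec_sq_le hP (Q⁻¹ *ᵥ w) (P⁻¹ *ᵥ w)
  have h2 := h (Q⁻¹ *ᵥ w)
  rw [mulVec_mulVec_inv hP, dotProduct_comm (P⁻¹ *ᵥ w), dotProduct_comm _ w] at h1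
  rw [mulVec_mulVec_inv hQ, dotProduct_comm _ w] at h2
  have h3 := dotProduct_mulVec_self_nonneg hP (Q⁻¹ *ᵥ w)
  have h4 := dotProduct_mulVec_self_nonneg hP.inv w
  have h5 := dotProduct_mulVec_self_nonneg hQ.inv w
  set a := w ⬝ᵥ (Q⁻¹ *ᵥ w)
  set b := w ⬝ᵥ (P⁻¹ *ᵥ w)
  rcases le_or_gt c 0 with hc | hc
  · nlinarith
  rcases h5.eq_or_lt with ha | ha
  · rw [← ha]; simpa using h4
  have h6 := mul_le_mul_of_nonneg_left h1 hc.le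
  have h7 := mul_le_mul_of_nonneg_right h2 h4
  exact le_of_mul_le_mul_right (by nlinarith : c * a * a ≤ b * a) ha

theorem form_mul_mul_transpose (A : Matrix (Fin p) (Fin n) ℝ) (R : Matrix (Fin n) (Fin n) ℝ)
    (v w : Fin p → ℝ) : v ⬝ᵥ ((A * R * Aᵀ) *ᵥ w) = (Aᵀ *ᵥ v) ⬝ᵥ (R *ᵥ (Aᵀ *ᵥ w)) := by
  rw [← Matrix.mulVec_mulVec, ← Matrix.mulVec_mulVec, Matrix.dotProduct_mulVec,
    Matrix.mulVec_transpose A v]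

theorem wnorm_mul_mul_transpose (A : Matrix (Fin p) (Fin n) ℝ) (R : Matrix (Fin n) (Fin n) ℝ)
    (v : Fin p → ℝ) : wnorm (A * R * Aᵀ) v = wnorm R (Aᵀ *ᵥ v) := by
  rw [wnorm, form_mul_mul_transpose, wnorm]

theorem posDef_mul_mul_transpose {A : Matrix (Fin p) (Fin n) ℝ} (hA : A.rank = p)
    {R : Matrix (Fin n) (Fin n) ℝ} (hR : R.PosDef) : (A * R * Aᵀ).PosDef := by
  refine hR.mul_mul_conjTranspose_same (Matrix.vecMul_injective_iff.2 ?_)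
  rw [linearIndependent_iff_card_eq_finrank_span, Fintype.card_fin,
    Set.finrank, ← Matrix.rank_eq_finrank_span_row, hA]

/-- Duality to `‖z‖_H = ‖Aᵀz‖_{P⁻¹}`: for `z = H⁻¹Av`, `‖Av‖²_{H⁻¹} = ⟨v, Aᵀz⟩ ≤ ‖v‖_P ‖Av‖_{H⁻¹}`.
It turns δ-closeness of `ũ` into the gradient error bound. -/
theorem wnorm_inv_mulVec_le {A : Matrix (Fin p) (Fin n) ℝ} (hA : A.rank = p)
    {P : Matrix (Fin n) (Fin n) ℝ} (hP : P.PosDef) (v : Fin n → ℝ) :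
    wnorm (A * P⁻¹ * Aᵀ)⁻¹ (A *ᵥ v) ≤ wnorm P v := by
  have hH := posDef_mul_mul_transpose hA hP.inv
  set H := A * P⁻¹ * Aᵀ with hHdef
  set z := H⁻¹ *ᵥ (A *ᵥ v) with hz
  have h1 : wnorm H⁻¹ (A *ᵥ v) ^ 2 = v ⬝ᵥ (Aᵀ *ᵥ z) := by
    rw [wnorm_sq hH.inv, ← hz, dotProduct_comm, Matrix.dotProduct_mulVec,
      ← Matrix.mulVec_transpose, dotProduct_comm]
  have h2 : wnorm P⁻¹ (Aᵀ *ᵥ z) = wnorm H⁻¹ (A *ᵥ v) := by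
    rw [← wnorm_mul_mul_transpose, ← hHdef, wnorm, hz, mulVec_mulVec_inv hH, dotProduct_comm, wnorm]
  have h3 := (le_abs_self _).trans (abs_dotProduct_le hP v (Aᵀ *ᵥ z))
  rw [← h1, h2, sq] at h3
  rcases (wnorm_nonneg H⁻¹ (A *ᵥ v)).eq_or_lt with h | h
  · rw [← h]; exact wnorm_nonneg _ _
  · exact le_of_mul_le_mul_right h3 h

theorem grad_dotProduct {φ : (Fin n → ℝ) → ℝ} (u w : Fin n → ℝ) :
    grad φ u ⬝ᵥ w = fderiv ℝ φ u w := by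
  conv_rhs => rw [pi_eq_sum_univ' w]
  simp only [map_sum, map_smul, dotProduct, grad, smul_eq_mul]
  exact Finset.sum_congr rfl fun i _ => mul_comm _ _

theorem dotProduct_hess_mulVec {φ : (Fin n → ℝ) → ℝ} (u v w : Fin n → ℝ) :
    v ⬝ᵥ (hess φ u *ᵥ w) = hessForm φ u v w := by
  let B : (Fin n → ℝ) →ₗ[ℝ] (Fin n → ℝ) →ₗ[ℝ] ℝ :=
    ContinuousLinearMap.coeLM ℝ ∘ₗ (hessForm φ u).toLinearMap
  have h : hess φ u = LinearMap.toMatrix₂' ℝ B := by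
    ext i j
    rw [LinearMap.toMatrix₂'_apply]
    rfl
  rw [h, ← Matrix.toLinearMap₂'_apply', Matrix.toLinearMap₂'_toMatrix']
  rfl

theorem wnorm_hess {φ : (Fin n → ℝ) → ℝ} (u v : Fin n → ℝ) :
    wnorm (hess φ u) v = localNorm φ u v := by
  rw [wnorm, dotProduct_hess_mulVec, localNorm]

end Matrix

/-- The line restriction is used at `τ = 0` only, since `u` ranges over `D`. The first two
derivatives are identified on a neighbourhood of `0` so that they can be differentiated again. -/
theorem IsStandardSelfConcordant.isSelfConcordantOn {n : ℕ} {φ : (Fin n → ℝ) → ℝ}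
    {D : Set (Fin n → ℝ)} (hφ : IsStandardSelfConcordant φ D) : IsSelfConcordantOn φ D where
  isOpen := hφ.isOpen
  convex := hφ.convexOn.1
  contDiffOn := hφ.contDiffOn
  pos u hu v hv := by
    rw [← dotProduct_hess_mulVec]
    simpa using (hφ.hess_posDef u hu).dotProduct_mulVec_pos hv
  third u hu v := by
    have hc : ∀ᶠ t : ℝ in nhds 0, ContDiffAt ℝ 3 φ (u + t • v) := by
      have : Filter.Tendsto (fun t : ℝ => u + t • v) (nhds 0) (nhds u) := by
        have : Continuous fun t : ℝ => u + t • v := by fun_prop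
        simpa using this.tendsto 0
      exact this.eventually
        ((hφ.contDiffOn.contDiffAt (hφ.isOpen.mem_nhds hu)).eventually (by simp))
    have e1 : iteratedDeriv 1 (fun t : ℝ => φ (u + t • v)) =ᶠ[nhds 0]
        fun t => fderiv ℝ φ (u + t • v) v := by
      filter_upwards [hc] with t ht
      rw [iteratedDeriv_one, (hasDerivAt_line ht).deriv]
    have e2 : iteratedDeriv 2 (fun t : ℝ => φ (u + t • v)) =ᶠ[nhds 0]
        fun t => hessForm φ (u + t • v) v v := by
      filter_upwards [e1.eventuallyEq_nhds, hc] with t h1 ht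
      rw [iteratedDeriv_succ, h1.deriv_eq, (hasDerivAt_fderiv_line ht).deriv]
    have e3 : iteratedDeriv 3 (fun t : ℝ => φ (u + t • v)) 0 = thirdForm φ u v v v := by
      rw [iteratedDeriv_succ, e2.deriv_eq, (hasDerivAt_hessForm_line hc.self_of_nhds).deriv]
      simp
    have h := (hφ.along_lines u hu v).bound 0 (by simpa using hu)
    rw [e3, e2.eq_of_nhds] at h
    simp only [zero_smul, add_zero] at h
    refine h.trans_eq ?_
    have h0 : 0 ≤ hessForm φ u v v := by
      rw [← dotProduct_hess_mulVec]
      exact dotProduct_mulVec_self_nonneg (hφ.hess_posDef u hu) v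
    rw [localNorm, Real.sqrt_eq_rpow, ← Real.rpow_natCast, ← Real.rpow_mul h0]
    norm_num

/-! ### The max function: values, domain, convexity, subgradients -/

variable {n p : ℕ} {φ : (Fin n → ℝ) → ℝ} {D : Set (Fin n → ℝ)} {A : Matrix (Fin p) (Fin n) ℝ}

/-- The linear functional `u ↦ ⟨u, Aᵀx⟩`. -/
def pairing (A : Matrix (Fin p) (Fin n) ℝ) (x : Fin p → ℝ) : (Fin n → ℝ) →L[ℝ] ℝ :=
  LinearMap.toContinuousLinearMap
    { toFun := fun u => u ⬝ᵥ (Aᵀ *ᵥ x)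
      map_add' := fun u v => add_dotProduct u v _
      map_smul' := fun c u => smul_dotProduct c u _ }

theorem pairing_apply (A : Matrix (Fin p) (Fin n) ℝ) (x : Fin p → ℝ) (u : Fin n → ℝ) :
    pairing A x u = u ⬝ᵥ (Aᵀ *ᵥ x) := rfl

theorem isGreatest_maxFun {x : Fin p → ℝ} {us : Fin n → ℝ} (h : IsExactSolution φ D A x us) :
    IsGreatest ((fun u => u ⬝ᵥ (Aᵀ *ᵥ x) - φ u) '' D) (us ⬝ᵥ (Aᵀ *ᵥ x) - φ us) := by
  refine ⟨⟨us, h.1, rfl⟩, ?_⟩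
  rintro _ ⟨u, hu, rfl⟩
  have := h.2 u hu
  dsimp only
  linarith

theorem maxFun_eq {x : Fin p → ℝ} {us : Fin n → ℝ} (h : IsExactSolution φ D A x us) :
    maxFun φ D A x = us ⬝ᵥ (Aᵀ *ᵥ x) - φ us :=
  (isGreatest_maxFun h).csSup_eq

theorem mem_maxDom_of_le {x : Fin p → ℝ} {M : ℝ} (h : ∀ u ∈ D, u ⬝ᵥ (Aᵀ *ᵥ x) - φ u ≤ M) :
    x ∈ maxDom φ D A := by
  refine ⟨-M, ?_⟩
  rintro _ ⟨u, hu, rfl⟩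
  have := h u hu
  dsimp only
  linarith

theorem IsExactSolution.mem_maxDom {x : Fin p → ℝ} {us : Fin n → ℝ}
    (h : IsExactSolution φ D A x us) : x ∈ maxDom φ D A :=
  mem_maxDom_of_le fun u hu => (isGreatest_maxFun h).2 ⟨u, hu, rfl⟩

theorem le_maxFun {x : Fin p → ℝ} (hx : x ∈ maxDom φ D A) {u : Fin n → ℝ} (hu : u ∈ D) :
    u ⬝ᵥ (Aᵀ *ᵥ x) - φ u ≤ maxFun φ D A x := by
  refine le_csSup ?_ ⟨u, hu, rfl⟩
  obtain ⟨M, hM⟩ := hx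
  refine ⟨-M, ?_⟩
  rintro _ ⟨u, hu, rfl⟩
  have := hM ⟨u, hu, rfl⟩
  dsimp only at this ⊢
  linarith

theorem maxFun_le (hD : D.Nonempty) {x : Fin p → ℝ} {M : ℝ}
    (h : ∀ u ∈ D, u ⬝ᵥ (Aᵀ *ᵥ x) - φ u ≤ M) : maxFun φ D A x ≤ M := by
  refine csSup_le (hD.image _) ?_
  rintro _ ⟨u, hu, rfl⟩
  exact h u hu

theorem convexOn_maxFun (hD : D.Nonempty) : ConvexOn ℝ (maxDom φ D A) (maxFun φ D A) := by
  have key {x y : Fin p → ℝ} (hx : x ∈ maxDom φ D A) (hy : y ∈ maxDom φ D A) {a b : ℝ}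
      (ha : 0 ≤ a) (hb : 0 ≤ b) (hab : a + b = 1) (u : Fin n → ℝ) (hu : u ∈ D) :
      u ⬝ᵥ (Aᵀ *ᵥ (a • x + b • y)) - φ u ≤ a • maxFun φ D A x + b • maxFun φ D A y := by
    have h1 := mul_le_mul_of_nonneg_left (le_maxFun hx hu) ha
    have h2 := mul_le_mul_of_nonneg_left (le_maxFun hy hu) hb
    rw [Matrix.mulVec_add, Matrix.mulVec_smul, Matrix.mulVec_smul, dotProduct_add,
      dotProduct_smul, dotProduct_smul]
    simp only [smul_eq_mul]
    have h3 : φ u = a * φ u + b * φ u := by rw [← add_mul, hab, one_mul]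
    linarith
  refine ⟨fun x hx y hy a b ha hb hab => mem_maxDom_of_le (key hx hy ha hb hab),
    fun x hx y hy a b ha hb hab => maxFun_le hD (key hx hy ha hb hab)⟩

theorem mulVec_dotProduct (u : Fin n → ℝ) (z : Fin p → ℝ) :
    (A *ᵥ u) ⬝ᵥ z = u ⬝ᵥ (Aᵀ *ᵥ z) := by
  rw [dotProduct_comm, Matrix.dotProduct_mulVec, Matrix.mulVec_transpose, dotProduct_comm]

theorem maxFun_subgradient {x y : Fin p → ℝ} {us : Fin n → ℝ} (h : IsExactSolution φ D A x us)
    (hy : y ∈ maxDom φ D A) :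
    maxFun φ D A x + (A *ᵥ us) ⬝ᵥ (y - x) ≤ maxFun φ D A y := by
  have h1 := le_maxFun hy h.1
  rw [maxFun_eq h, mulVec_dotProduct, Matrix.mulVec_sub,
    dotProduct_sub]
  linarith

/-! ### The max function at an exact solution: growth bounds and derivatives -/

namespace IsStandardSelfConcordant

variable (hφ : IsStandardSelfConcordant φ D)
include hφ

theorem isExactSolution_iff {x : Fin p → ℝ} {us : Fin n → ℝ} (hus : us ∈ D) :
    IsExactSolution φ D A x us ↔ fderiv ℝ φ us = pairing A x :=
  ⟨fun h => hφ.isSelfConcordantOn.fderiv_eq_of_isMinOn hus (pairing A x) h.2,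
    fun h => ⟨hus, hφ.isSelfConcordantOn.isMinOn_of_fderiv_eq hus (pairing A x) h⟩⟩

theorem isExactSolution_iff_grad {x : Fin p → ℝ} {us : Fin n → ℝ} (hus : us ∈ D) :
    IsExactSolution φ D A x us ↔ grad φ us = Aᵀ *ᵥ x := by
  rw [hφ.isExactSolution_iff hus]
  constructor
  · intro h
    ext i
    rw [grad, h, pairing_apply, single_one_dotProduct]
  · intro h
    ext1 w
    rw [← grad_dotProduct, h, pairing_apply, dotProduct_comm]

/-- The supremum defining `f(y)` is tested at a damped Newton step from `us`, which stays in the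
Dikin ellipsoid. The `ω_*` bound on `φ` there becomes `ω` by conjugacy. -/
theorem le_maxFun_of_exact {x y : Fin p → ℝ} {us : Fin n → ℝ} (h : IsExactSolution φ D A x us)
    (hy : y ∈ maxDom φ D A) :
    maxFun φ D A x + (A *ᵥ us) ⬝ᵥ (y - x)
      + omega (wnorm (A * (hess φ us)⁻¹ * Aᵀ) (y - x)) ≤ maxFun φ D A y := by
  have hs := hφ.isSelfConcordantOn
  have hP := hφ.hess_posDef us h.1
  obtain ⟨w, hw⟩ : ∃ w, w = Aᵀ *ᵥ (y - x) := ⟨_, rfl⟩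
  rw [wnorm_mul_mul_transpose, mulVec_dotProduct, ← hw]
  obtain ⟨r, hr⟩ : ∃ r, r = wnorm (hess φ us)⁻¹ w := ⟨_, rfl⟩
  have hr0 : 0 ≤ r := hr ▸ wnorm_nonneg _ _
  rw [← hr]
  -- The damping makes the local length `s = r/(1 + r)`, the maximiser of `s r - ω_*(s)`.
  set d := (1 + r)⁻¹ • ((hess φ us)⁻¹ *ᵥ w) with hd
  have hinv : 0 ≤ (1 + r)⁻¹ := by positivity
  have hnorm : localNorm φ us (us + d - us) = r / (1 + r) := by
    rw [add_sub_cancel_left, hd, localNorm_smul _ _ _ hinv, ← wnorm_hess, wnorm,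
      mulVec_mulVec_inv hP, dotProduct_comm, hr, wnorm, inv_mul_eq_div]
  have hlt : r / (1 + r) < 1 := by rw [div_lt_one (by positivity)]; linarith
  have hmem : us + d ∈ D :=
    hs.mem_of_localNorm_lt_one hφ.closed_epigraph h.1 (by rw [hnorm]; exact hlt)
  have h1 := hs.le_omegaStar h.1 hmem (by rw [hnorm]; exact hlt)
  rw [hnorm, add_sub_cancel_left, (hφ.isExactSolution_iff h.1).1 h, pairing_apply] at h1
  have h2 := le_maxFun hy hmem
  have h3 : d ⬝ᵥ w = r / (1 + r) * r := by
    rw [hd, smul_dotProduct, dotProduct_comm _ w, ← wnorm_sq hP.inv, ← hr, smul_eq_mul]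
    ring
  have h4 : Aᵀ *ᵥ y = Aᵀ *ᵥ x + w := by rw [hw, Matrix.mulVec_sub]; abel
  rw [h4, add_dotProduct, dotProduct_add, dotProduct_add, h3] at h2
  rw [maxFun_eq h, ← mul_sub_omegaStar_eq_omega hr0]
  linarith

/-- The `ω` lower bound on `φ` combined with Fenchel–Young. It is stated for each `u`, so that it
yields both membership of `y` in the domain and the upper bound on the supremum. -/
theorem pairing_le_of_exact {x y : Fin p → ℝ} {us : Fin n → ℝ} (h : IsExactSolution φ D A x us)
    (hr : wnorm (A * (hess φ us)⁻¹ * Aᵀ) (y - x) < 1) (u : Fin n → ℝ) (hu : u ∈ D) :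
    u ⬝ᵥ (Aᵀ *ᵥ y) - φ u ≤ maxFun φ D A x + (A *ᵥ us) ⬝ᵥ (y - x)
      + omegaStar (wnorm (A * (hess φ us)⁻¹ * Aᵀ) (y - x)) := by
  have hs := hφ.isSelfConcordantOn
  have hP := hφ.hess_posDef us h.1
  obtain ⟨w, hw⟩ : ∃ w, w = Aᵀ *ᵥ (y - x) := ⟨_, rfl⟩
  rw [wnorm_mul_mul_transpose, ← hw] at hr
  rw [wnorm_mul_mul_transpose, mulVec_dotProduct, ← hw]
  have h1 := hs.omega_le h.1 hu
  rw [(hφ.isExactSolution_iff h.1).1 h, pairing_apply, sub_dotProduct] at h1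
  have h2 := (le_abs_self _).trans (abs_dotProduct_le hP (u - us) w)
  rw [wnorm_hess, sub_dotProduct] at h2
  have h3 := mul_sub_omega_le_omegaStar hr (localNorm_nonneg φ us (u - us))
  have h4 : Aᵀ *ᵥ y = Aᵀ *ᵥ x + w := by rw [hw, Matrix.mulVec_sub]; abel
  rw [h4, dotProduct_add, maxFun_eq h]
  linarith

theorem contDiffAt_grad {u : Fin n → ℝ} (hu : u ∈ D) : ContDiffAt ℝ 2 (grad φ) u := by
  refine contDiffAt_pi.2 fun i => ?_
  exact ((hφ.isSelfConcordantOn.contDiffAt hu).fderiv_right (m := 2) (by norm_num)).clm_apply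
    contDiffAt_const

/-- The Hessian at a point as a continuous linear automorphism. -/
def hessEquiv {u : Fin n → ℝ} (hu : u ∈ D) : (Fin n → ℝ) ≃L[ℝ] (Fin n → ℝ) :=
  (LinearEquiv.ofLinearMap (hess φ u).mulVecLin (hess φ u)⁻¹.mulVecLin
    (LinearMap.ext fun w => mulVec_mulVec_inv (hφ.hess_posDef u hu) w)
    (LinearMap.ext fun w => inv_mulVec_mulVec (hφ.hess_posDef u hu) w)).toContinuousLinearEquiv

theorem hasFDerivAt_grad {u : Fin n → ℝ} (hu : u ∈ D) :
    HasFDerivAt (grad φ) (hφ.hessEquiv hu : (Fin n → ℝ) →L[ℝ] Fin n → ℝ) u := by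
  have hc := hφ.isSelfConcordantOn.contDiffAt hu
  refine hasFDerivAt_pi'.2 fun i => ?_
  refine ((hasFDerivAt_hessForm hc).clm_apply (hasFDerivAt_const (Pi.single i 1) u)).congr_fderiv ?_
  ext1 w
  have : hφ.hessEquiv hu w i = hessForm φ u w (Pi.single i 1) := by
    rw [hessForm_symm hc, ← dotProduct_hess_mulVec, single_one_dotProduct]
    rfl
  simpa using this.symm

/-- Near a solvable `x`, the solution map is a `C²` function. -/
theorem exists_solution_map {x : Fin p → ℝ} {us : Fin n → ℝ} (h : IsExactSolution φ D A x us) :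
    ∃ v : (Fin p → ℝ) → Fin n → ℝ, ContDiffAt ℝ 2 v x ∧ v x = us ∧
      (∀ᶠ y in nhds x, IsExactSolution φ D A y (v y)) ∧
      ∃ v' : (Fin p → ℝ) →L[ℝ] Fin n → ℝ, HasFDerivAt v v' x ∧
        ∀ z, v' z = (hess φ us)⁻¹ *ᵥ (Aᵀ *ᵥ z) := by
  have hc := hφ.contDiffAt_grad h.1
  have hd := hφ.hasFDerivAt_grad h.1
  have hg := (hφ.isExactSolution_iff_grad h.1).1 h
  set L : (Fin p → ℝ) →L[ℝ] Fin n → ℝ := Aᵀ.mulVecLin.toContinuousLinearMap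
  have hLx : grad φ us = L x := hg
  -- Inverse function theorem for `grad φ` at `us`: the solution map is the local inverse composed
  -- with `Aᵀ`.
  have hstrict := hc.hasStrictFDerivAt' hd (by norm_num)
  set g := hc.localInverse hd (by norm_num)
  have hgc : ContDiffAt ℝ 2 g (L x) := hLx ▸ hc.to_localInverse hd (by norm_num)
  have hgx : g (L x) = us := hLx ▸ hc.localInverse_apply_image hd (by norm_num)
  have hgr : ∀ᶠ z in nhds (L x), grad φ (g z) = z :=
    hLx ▸ hstrict.eventually_right_inverse
  have hgd : HasFDerivAt g ((hφ.hessEquiv h.1).symm : (Fin n → ℝ) →L[ℝ] Fin n → ℝ) (L x) :=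
    hLx ▸ hstrict.to_localInverse.hasFDerivAt
  have hLt : Filter.Tendsto L (nhds x) (nhds (L x)) := L.continuous.continuousAt
  have hvc : ContDiffAt ℝ 2 (fun y => g (L y)) x := hgc.comp x L.contDiff.contDiffAt
  refine ⟨fun y => g (L y), hvc, hgx, ?_, _, hgd.comp x L.hasFDerivAt, fun z => rfl⟩
  have hD : ∀ᶠ y in nhds x, g (L y) ∈ D :=
    hvc.continuousAt.eventually (by
      beta_reduce
      rw [hgx]
      exact hφ.isOpen.mem_nhds h.1)
  filter_upwards [hD, hLt.eventually hgr] with y hy1 hy2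
  exact (hφ.isExactSolution_iff_grad hy1).2 hy2

/-- Regularity comes from substituting the `C²` solution map `v`. The gradient comes from Fermat's
rule: by the subgradient inequality, `f - ⟨A v(y), ·⟩` has a local minimum at `y`. The Hessian is
the derivative of `A v`. -/
theorem contDiffAt_maxFun {x : Fin p → ℝ} {us : Fin n → ℝ} (h : IsExactSolution φ D A x us) :
    ContDiffAt ℝ 2 (maxFun φ D A) x ∧ grad (maxFun φ D A) x = A *ᵥ us ∧
      hess (maxFun φ D A) x = A * (hess φ us)⁻¹ * Aᵀ := by
  obtain ⟨v, hv, hvx, hsol, v', hv', hv'z⟩ := hφ.exists_solution_map h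
  have hA (i : Fin p) : ContDiff ℝ 2 fun u : Fin n → ℝ => (A *ᵥ u) i := by
    simp only [Matrix.mulVec, dotProduct]
    fun_prop
  have hC : ContDiffAt ℝ 2 (maxFun φ D A) x := by
    have h1 : ContDiffAt ℝ 2 (fun y => (∑ i, (A *ᵥ v y) i * y i) - φ (v y)) x := by
      refine ContDiffAt.sub (ContDiffAt.sum fun i _ => ?_) ?_
      · exact ((hA i).contDiffAt.comp x hv).mul (contDiff_apply ℝ ℝ i).contDiffAt
      · refine ContDiffAt.comp x ?_ hv
        rw [hvx]
        exact (hφ.isSelfConcordantOn.contDiffAt h.1).of_le (by norm_num)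
    refine h1.congr_of_eventuallyEq ?_
    filter_upwards [hsol] with y hy
    rw [maxFun_eq hy, ← mulVec_dotProduct]
    rfl
  have hgrad : ∀ᶠ y in nhds x, ∀ w, fderiv ℝ (maxFun φ D A) y w = (A *ᵥ v y) ⬝ᵥ w := by
    filter_upwards [hC.eventually (by simp), hsol.eventually_nhds] with y hy hysol
    let ℓ : (Fin p → ℝ) →L[ℝ] ℝ := LinearMap.toContinuousLinearMap
      { toFun := fun w => (A *ᵥ v y) ⬝ᵥ w
        map_add' := fun a b => dotProduct_add _ a b
        map_smul' := fun c a => dotProduct_smul c _ a }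
    have hmin : IsLocalMin (fun z => maxFun φ D A z - ℓ z) y := by
      filter_upwards [hysol] with z hz
      have h1 := maxFun_subgradient hysol.self_of_nhds hz.mem_maxDom
      rw [dotProduct_sub] at h1
      have h2 : ℓ z = (A *ᵥ v y) ⬝ᵥ z := rfl
      have h3 : ℓ y = (A *ᵥ v y) ⬝ᵥ y := rfl
      linarith
    have h0 := hmin.hasFDerivAt_eq_zero
      ((hy.differentiableAt (by norm_num)).hasFDerivAt.sub ℓ.hasFDerivAt)
    intro w
    rw [sub_eq_zero.1 h0]
    rfl
  refine ⟨hC, ?_, ?_⟩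
  · ext i
    rw [grad, hgrad.self_of_nhds, hvx, dotProduct_single_one]
  -- Differentiating component `j` of `A v` in direction `i` produces the `(j, i)` entry, so
  -- symmetry is needed to match the `(i, j)` entry of the Hessian.
  · have hsymm : (A * (hess φ us)⁻¹ * Aᵀ)ᵀ = A * (hess φ us)⁻¹ * Aᵀ := by
      have h1 : ((hess φ us)⁻¹)ᵀ = (hess φ us)⁻¹ := (hφ.hess_posDef us h.1).inv.isHermitian
      rw [Matrix.transpose_mul, Matrix.transpose_mul, Matrix.transpose_transpose, h1,
        Matrix.mul_assoc]
    have hdd : HasFDerivAt (fderiv ℝ (maxFun φ D A))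
        (fderiv ℝ (fderiv ℝ (maxFun φ D A)) x) x :=
      ((hC.fderiv_right (m := 1) (by norm_num)).differentiableAt (by norm_num)).hasFDerivAt
    ext i j
    have h1 := hdd.clm_apply (hasFDerivAt_const (Pi.single j (1 : ℝ)) x)
    let π : (Fin n → ℝ) →L[ℝ] ℝ :=
      (LinearMap.proj j ∘ₗ A.mulVecLin).toContinuousLinearMap
    have h2 : HasFDerivAt (fun y => π (v y)) (π.comp v') x := π.hasFDerivAt.comp x hv'
    have h3 : (fun y => fderiv ℝ (maxFun φ D A) y (Pi.single j 1)) =ᶠ[nhds x]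
        fun y => π (v y) := by
      filter_upwards [hgrad] with y hy
      rw [hy, dotProduct_single_one]
      rfl
    have h4 := DFunLike.congr_fun (h1.unique (h2.congr_of_eventuallyEq h3)) (Pi.single i (1 : ℝ))
    have h5 : π (v' (Pi.single i 1)) = (A * (hess φ us)⁻¹ * Aᵀ) j i := by
      have : π (v' (Pi.single i 1)) = (A *ᵥ (v' (Pi.single i 1))) j := rfl
      rw [this, hv'z, Matrix.mulVec_mulVec, Matrix.mulVec_mulVec, Matrix.mulVec_single_one]
      simp [Matrix.mul_assoc]
    rw [← hsymm, Matrix.transpose_apply, ← h5]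
    simpa [hess] using h4

end IsStandardSelfConcordant

end SCOracle

end

/-! ### From exact solutions to δ-solutions -/

namespace SCOracle

variable {n p : ℕ} {φ : (Fin n → ℝ) → ℝ} {D : Set (Fin n → ℝ)} {A : Matrix (Fin p) (Fin n) ℝ}

theorem localNorm_sub_comm (φ : (Fin n → ℝ) → ℝ) (w u v : Fin n → ℝ) :
    localNorm φ w (u - v) = localNorm φ w (v - u) := by
  have : u - v = -(v - u) := by abel
  rw [this]
  generalize v - u = d
  simp [localNorm]

/-- Comparison of the Hessians at two points at local distance at most `δ`. -/
theorem IsSelfConcordantOn.dotProduct_hess_comparison (hs : IsSelfConcordantOn φ D) {δ : ℝ}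
    (h1 : δ < 1) {u v : Fin n → ℝ} (hu : u ∈ D) (hv : v ∈ D)
    (h : wnorm (hess φ u) (u - v) ≤ δ) (w : Fin n → ℝ) :
    (1 - δ) ^ 2 * (w ⬝ᵥ (hess φ v *ᵥ w)) ≤ w ⬝ᵥ (hess φ u *ᵥ w) ∧
      (1 - δ) ^ 2 * (w ⬝ᵥ (hess φ u *ᵥ w)) ≤ w ⬝ᵥ (hess φ v *ᵥ w) := by
  rw [wnorm_hess, localNorm_sub_comm] at h
  have hc := hs.hessForm_comparison hu hv (h.trans_lt h1) w
  have hle : (1 - δ) ^ 2 ≤ (1 - localNorm φ u (v - u)) ^ 2 :=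
    pow_le_pow_left₀ (by linarith) (by linarith) 2
  rw [dotProduct_hess_mulVec, dotProduct_hess_mulVec]
  exact ⟨(mul_le_mul_of_nonneg_right hle (hs.hessForm_nonneg hv w)).trans hc.1,
    (mul_le_mul_of_nonneg_right hle (hs.hessForm_nonneg hu w)).trans hc.2⟩

theorem mul_sqrt_le_sqrt {c a b : ℝ} (hc : 0 ≤ c) (h : c ^ 2 * a ≤ b) :
    c * Real.sqrt a ≤ Real.sqrt b := by
  calc c * Real.sqrt a = Real.sqrt (c ^ 2 * a) := by
        rw [Real.sqrt_mul (sq_nonneg c), Real.sqrt_sq hc]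
    _ ≤ Real.sqrt b := Real.sqrt_le_sqrt h

namespace IsStandardSelfConcordant

variable (hφ : IsStandardSelfConcordant φ D)
include hφ

theorem approxHess_comparison {δ : ℝ} (h1 : δ < 1) {u v : Fin n → ℝ} (hu : u ∈ D) (hv : v ∈ D)
    (h : wnorm (hess φ u) (u - v) ≤ δ) (z : Fin p → ℝ) :
    (1 - δ) ^ 2 * (z ⬝ᵥ ((A * (hess φ u)⁻¹ * Aᵀ) *ᵥ z)) ≤ z ⬝ᵥ ((A * (hess φ v)⁻¹ * Aᵀ) *ᵥ z) ∧
      (1 - δ) ^ 2 * (z ⬝ᵥ ((A * (hess φ v)⁻¹ * Aᵀ) *ᵥ z))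
        ≤ z ⬝ᵥ ((A * (hess φ u)⁻¹ * Aᵀ) *ᵥ z) := by
  have hc := hφ.isSelfConcordantOn.dotProduct_hess_comparison h1 hu hv h
  simp only [form_mul_mul_transpose]
  exact ⟨inv_form_le (hφ.hess_posDef v hv) (hφ.hess_posDef u hu) (fun w => (hc w).1) _,
    inv_form_le (hφ.hess_posDef u hu) (hφ.hess_posDef v hv) (fun w => (hc w).2) _⟩

/-- The gap is that of `φ - ⟨·, Aᵀx⟩` between `u` and its minimiser. The `ω_*` bound is based at
`us`, and moving the local norm from `u` to `us` inflates `δ` to `δ/(1 - δ)`, which is below one as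
`δ < 1/2`. -/
theorem maxFun_sub_le {δ : ℝ} (h2 : δ < 1 / 2) {x : Fin p → ℝ} {u us : Fin n → ℝ} (hu : u ∈ D)
    (hus : IsExactSolution φ D A x us) (h : wnorm (hess φ u) (u - us) ≤ δ) :
    maxFun φ D A x - (u ⬝ᵥ (Aᵀ *ᵥ x) - φ u) ≤ omegaStar (δ / (1 - δ)) := by
  have hs := hφ.isSelfConcordantOn
  have hd : 0 < 1 - δ := by linarith
  have hc := mul_sqrt_le_sqrt hd.le
    (hs.dotProduct_hess_comparison (by linarith) hu hus.1 h (u - us)).1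
  change (1 - δ) * wnorm _ _ ≤ wnorm _ _ at hc
  have h3 : localNorm φ us (u - us) ≤ δ / (1 - δ) := by
    rw [le_div_iff₀ hd, ← wnorm_hess]
    linarith
  have h4 : δ / (1 - δ) < 1 := by rw [div_lt_one hd]; linarith
  have h5 := hs.le_omegaStar hus.1 hu (h3.trans_lt h4)
  rw [(hφ.isExactSolution_iff hus.1).1 hus, pairing_apply, sub_dotProduct] at h5
  have h6 := omegaStar_mono (localNorm_nonneg φ us (u - us)) h3 h4
  rw [maxFun_eq hus]
  linarith

theorem abs_mulVec_sub_dotProduct_le {δ : ℝ} {u us : Fin n → ℝ} (hu : u ∈ D)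
    (h : wnorm (hess φ u) (u - us) ≤ δ) (z : Fin p → ℝ) :
    |(A *ᵥ u) ⬝ᵥ z - (A *ᵥ us) ⬝ᵥ z| ≤ δ * wnorm (A * (hess φ u)⁻¹ * Aᵀ) z := by
  rw [mulVec_dotProduct, mulVec_dotProduct, ← sub_dotProduct, wnorm_mul_mul_transpose]
  exact (abs_dotProduct_le (hφ.hess_posDef u hu) _ _).trans
    (mul_le_mul_of_nonneg_right h (wnorm_nonneg _ _))

/-- The map `λ ↦ λ/(1 - λ)` sends the decrement bound `δ/(1 + δ) < 1` to `δ`. -/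
theorem isDeltaSolution_of_wnormDual_le {δ : ℝ} (hδ : 0 ≤ δ) {x : Fin p → ℝ} {u : Fin n → ℝ}
    (hu : u ∈ D) (h : wnormDual (hess φ u) (grad φ u - Aᵀ *ᵥ x) ≤ δ / (1 + δ)) :
    IsDeltaSolution φ D A x δ u := by
  have hs := hφ.isSelfConcordantOn
  have hlam (w : Fin n → ℝ) :
      |fderiv ℝ φ u w - pairing A x w| ≤ δ / (1 + δ) * localNorm φ u w := by
    have e : fderiv ℝ φ u w - pairing A x w = w ⬝ᵥ (grad φ u - Aᵀ *ᵥ x) := by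
      rw [dotProduct_sub, dotProduct_comm, grad_dotProduct, pairing_apply]
    rw [e, mul_comm, ← wnorm_hess]
    exact (abs_dotProduct_le (hφ.hess_posDef u hu) _ _).trans
      (mul_le_mul_of_nonneg_left h (wnorm_nonneg _ _))
  have h1 : δ / (1 + δ) < 1 := by rw [div_lt_one (by positivity)]; linarith
  obtain ⟨v, hv, hmin⟩ := hs.exists_isMinOn hφ.closed_epigraph hu (pairing A x) h1 hlam
  refine ⟨hu, v, ⟨hv, hmin⟩, ?_⟩
  have h2 := hs.localNorm_le_of_isMinOn hu hv (pairing A x) (by positivity) h1 hlam hmin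
  have h3 : δ / (1 + δ) / (1 - δ / (1 + δ)) = δ := by
    have : 1 + δ ≠ 0 := by positivity
    field_simp
    ring
  rw [wnorm_hess, localNorm_sub_comm, ← h3]
  exact h2

/-- The oracle inequalities at a `δ`-solution. -/
theorem oracle_bounds {δ : ℝ} (h0 : 0 ≤ δ) (hδ : δ ≤ 0.292) {x : Fin p → ℝ} {u us : Fin n → ℝ}
    (hu : u ∈ D) (hus : IsExactSolution φ D A x us) (h : wnorm (hess φ u) (u - us) ≤ δ)
    {y : Fin p → ℝ}
    (hr : wnorm (A * (hess φ u)⁻¹ * Aᵀ) (y - x) < 1 / (1 + acc0 δ (δ / (1 - δ)))) :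
    y ∈ maxDom φ D A ∧
    omega ((1 - acc0 δ (δ / (1 - δ))) * wnorm (A * (hess φ u)⁻¹ * Aᵀ) (y - x)) ≤
      maxFun φ D A y - (u ⬝ᵥ (Aᵀ *ᵥ x) - φ u - omegaStar (δ / (1 - δ)) + psiLower δ (δ / (1 - δ)))
        - (A *ᵥ u) ⬝ᵥ (y - x) ∧
    maxFun φ D A y - (u ⬝ᵥ (Aᵀ *ᵥ x) - φ u - omegaStar (δ / (1 - δ)) + psiLower δ (δ / (1 - δ)))
        - (A *ᵥ u) ⬝ᵥ (y - x) ≤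
      omegaStar ((1 + acc0 δ (δ / (1 - δ))) * wnorm (A * (hess φ u)⁻¹ * Aᵀ) (y - x))
        + acc1 (omegaStar (δ / (1 - δ))) δ (δ / (1 - δ)) := by
  norm_num at hδ
  have hd : 0 < 1 - δ := by linarith
  obtain ⟨δ₃, hδ₃⟩ : ∃ δ₃, δ₃ = δ / (1 - δ) := ⟨_, rfl⟩
  have h30 : 0 ≤ δ₃ := by rw [hδ₃]; positivity
  have h3mul : δ₃ * (1 - δ) = δ := by rw [hδ₃]; exact div_mul_cancel₀ _ hd.ne'
  have h3le : δ ≤ δ₃ := by nlinarith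
  -- Equivalent to `2δ² - 4δ + 1 > 0`, that is `δ < 1 - 1/√2 ≈ 0.2929` in the present range; this is
  -- the origin of `0.292`.
  have hacc : 2 * δ + δ₃ < 1 := by nlinarith
  have hval := hφ.maxFun_sub_le (by linarith) hu hus h
  have hval0 := (isGreatest_maxFun hus).2 ⟨u, hu, rfl⟩
  rw [← maxFun_eq hus] at hval0
  dsimp only at hval0
  have hlin := abs_le.1 (hφ.abs_mulVec_sub_dotProduct_le (A := A) hu h (y - x))
  have hcmp := hφ.approxHess_comparison (A := A) (by linarith : δ < 1) hu hus.1 h (y - x)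
  have hc1 := mul_sqrt_le_sqrt hd.le hcmp.1
  have hc2 := mul_sqrt_le_sqrt hd.le hcmp.2
  change (1 - δ) * wnorm _ _ ≤ wnorm _ _ at hc1 hc2
  rw [← hδ₃] at hr hval ⊢
  have ht0 := wnorm_nonneg (A * (hess φ u)⁻¹ * Aᵀ) (y - x)
  have hs0 := wnorm_nonneg (A * (hess φ us)⁻¹ * Aᵀ) (y - x)
  have hlow := hφ.le_maxFun_of_exact (y := y) hus
  have hup := hφ.pairing_le_of_exact (y := y) hus
  set t := wnorm (A * (hess φ u)⁻¹ * Aᵀ) (y - x)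
  set s := wnorm (A * (hess φ us)⁻¹ * Aᵀ) (y - x)
  have hst : (1 - δ₃) * t ≤ s :=
    (mul_le_mul_of_nonneg_right (by linarith) ht0).trans hc1
  -- `1 + δ₃` is exactly `1/(1 - δ)`; the lower comparison only uses `1 - δ₃ ≤ 1 - δ`.
  have hts : s ≤ (1 + δ₃) * t := by
    have h1 : (1 + δ₃) * (1 - δ) = 1 := by linarith
    have := mul_le_mul_of_nonneg_left hc2 (by linarith : 0 ≤ 1 + δ₃)
    rw [← mul_assoc, h1, one_mul] at this
    exact this
  have hlt1 : (1 + δ₃) * t < 1 := by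
    have hp : 0 < 1 + acc0 δ δ₃ := by rw [acc0]; positivity
    have h1 := (lt_div_iff₀ hp).1 hr
    rw [acc0] at h1
    nlinarith
  have hs1 : s < 1 := hts.trans_lt hlt1
  have hy : y ∈ maxDom φ D A := mem_maxDom_of_le (hup hs1)
  refine ⟨hy, ?_, ?_⟩
  -- The loss `δ t` from changing the gradient and the shrinkage of the norm are absorbed by
  -- `psiLower`; the value gap `f - f̃` and `ε` only help, being nonnegative.
  · have h1 := omega_acc0_le h0 hacc ht0
    have h2 := omega_mono (mul_nonneg (by linarith) ht0) hst
    linarith [hlow hy]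
  -- The `2ε` in the accuracy: one `ε` bounds the value gap `f - f̃`, the other is the shift built
  -- into `f̂`.
  · have h1 := le_omegaStar_acc0 h0 h30 ht0 hr
    have h2 := omegaStar_mono hs0 hts hlt1
    have h3 := maxFun_le ⟨u, hu⟩ (hup hs1)
    have h4 : 2 * omegaStar δ₃ + psiUpper δ δ₃ - psiLower δ δ₃ ≤ acc1 (omegaStar δ₃) δ δ₃ :=
      le_max_right _ _
    linarith

end IsStandardSelfConcordant

end SCOracle

/-! ### Assembly of the lemma -/

theorem lemma3p2 {n p : ℕ} (φ : (Fin n → ℝ) → ℝ) (D : Set (Fin n → ℝ))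
    (A : Matrix (Fin p) (Fin n) ℝ) (hφ : SCOracle.IsStandardSelfConcordant φ D) :
    (A.rank = p →
      ∀ δ : ℝ, 0 ≤ δ → δ ≤ 0.292 →
      ∀ ut : (Fin p → ℝ) → Fin n → ℝ,
        (∀ x ∈ SCOracle.maxDom φ D A, SCOracle.IsDeltaSolution φ D A x δ (ut x)) →
        SCOracle.IsGlobalInexactOracle
          (SCOracle.maxFun φ D A) (SCOracle.maxDom φ D A)
          (fun x => SCOracle.approxVal φ A ut x - SCOracle.omegaStar (δ / (1 - δ))
            + SCOracle.psiLower δ (δ / (1 - δ)))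
          (SCOracle.approxGrad A ut) (SCOracle.approxHess φ A ut)
          (SCOracle.acc0 δ (δ / (1 - δ)))
          (SCOracle.acc1 (SCOracle.omegaStar (δ / (1 - δ))) δ (δ / (1 - δ))) ∧
        ∀ x ∈ SCOracle.maxDom φ D A,
          ContDiffAt ℝ 2 (SCOracle.maxFun φ D A) x ∧
          SCOracle.wnormDual (SCOracle.approxHess φ A ut x)
            (SCOracle.approxGrad A ut x - SCOracle.grad (SCOracle.maxFun φ D A) x) ≤ δ ∧
          (SCOracle.approxHess φ A ut x
            - (1 - δ / (1 - δ)) ^ 2 • SCOracle.hess (SCOracle.maxFun φ D A) x).PosSemidef ∧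
          ((1 + δ / (1 - δ)) ^ 2 • SCOracle.hess (SCOracle.maxFun φ D A) x
            - SCOracle.approxHess φ A ut x).PosSemidef) ∧
    (∀ δ : ℝ, 0 ≤ δ → ∀ x ∈ SCOracle.maxDom φ D A, ∀ u ∈ D,
      SCOracle.wnormDual (SCOracle.hess φ u) (SCOracle.grad φ u - Aᵀ *ᵥ x) ≤ δ / (1 + δ) →
      SCOracle.IsDeltaSolution φ D A x δ u) := by
  refine ⟨fun hA δ h0 hδ ut hut => ?_,
    fun δ hδ x _ u hu h => hφ.isDeltaSolution_of_wnormDual_le hδ hu h⟩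
  have hδ' : δ ≤ 0.292 := hδ
  norm_num at hδ'
  have hd : 0 < 1 - δ := by linarith
  have h30 : 0 ≤ δ / (1 - δ) := by positivity
  have h3mul : δ / (1 - δ) * (1 - δ) = δ := div_mul_cancel₀ _ hd.ne'
  refine ⟨⟨SCOracle.convexOn_maxFun hφ.nonempty, ⟨?_, ?_⟩, le_max_left _ _, fun x hx => ?_⟩,
    fun x hx => ?_⟩
  · rw [SCOracle.acc0]; positivity
  · rw [SCOracle.acc0]; nlinarith
  · obtain ⟨hu, us, hus, h⟩ := hut x hx
    exact ⟨SCOracle.posDef_mul_mul_transpose hA (hφ.hess_posDef _ hu).inv,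
      fun y hy => hφ.oracle_bounds h0 hδ hu hus h hy⟩
  · obtain ⟨hu, us, hus, h⟩ := hut x hx
    obtain ⟨hC, hgrad, hhess⟩ := hφ.contDiffAt_maxFun hus
    have hH := SCOracle.posDef_mul_mul_transpose hA (hφ.hess_posDef _ hu).inv
    have hF := SCOracle.posDef_mul_mul_transpose hA (hφ.hess_posDef _ hus.1).inv
    have hcmp := hφ.approxHess_comparison (A := A) (by linarith : δ < 1) hu hus.1 h
    refine ⟨hC, ?_, ?_, ?_⟩
    · rw [hgrad, SCOracle.approxGrad, ← Matrix.mulVec_sub]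
      exact (SCOracle.wnorm_inv_mulVec_le hA (hφ.hess_posDef _ hu) _).trans h
    · rw [hhess]
      refine Matrix.PosSemidef.of_dotProduct_mulVec_nonneg
        (hH.isHermitian.sub (hF.isHermitian.smul (by simp [IsSelfAdjoint]))) fun z => ?_
      have h1 := (hcmp z).2
      -- The comparison gives the sharper factor `(1 - δ)²`; since `0 ≤ 1 - δ₃ ≤ 1 - δ`, it may be
      -- weakened.
      have h2 : (1 - δ / (1 - δ)) ^ 2 ≤ (1 - δ) ^ 2 :=
        pow_le_pow_left₀ (by nlinarith) (by nlinarith) 2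
      have h3 := mul_le_mul_of_nonneg_right h2 (SCOracle.dotProduct_mulVec_self_nonneg hF z)
      rw [star_trivial, Matrix.sub_mulVec, Matrix.smul_mulVec, dotProduct_sub, dotProduct_smul,
        smul_eq_mul, SCOracle.approxHess]
      linarith
    · rw [hhess]
      refine Matrix.PosSemidef.of_dotProduct_mulVec_nonneg
        ((hF.isHermitian.smul (by simp [IsSelfAdjoint])).sub hH.isHermitian) fun z => ?_
      have h1 := mul_le_mul_of_nonneg_left (hcmp z).1 (sq_nonneg (1 + δ / (1 - δ)))
      have h2 : (1 + δ / (1 - δ)) * (1 - δ) = 1 := by linarith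
      rw [← mul_assoc, ← mul_pow, h2, one_pow, one_mul] at h1
      rw [star_trivial, Matrix.sub_mulVec, Matrix.smul_mulVec, dotProduct_sub, dotProduct_smul,
        smul_eq_mul, SCOracle.approxHess]
      linarith
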